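/- Let $S$ be a complete separable metric space with Borel $\sigma$-algebra $\mathbf S$; write $\mathbb N=\{1,2,\dots\}$ and $\mathbb Z_+=\mathbb N\cup\{0\}$. A random measure on $S$ is a random element of the space of measures on $\mathbf S$ that are finite on bounded Borel sets. It is completely random (a CRM) if its values on disjoint Borel sets are independent. It is a point process if its values on bounded Borel sets are nonnegative integers. It is atomless if $\xi(\{x\})=0$ a.s. for every $x\in S$. A point $x\in S$ is a fixed atom of $\xi$ if $\mathbb P(\xi(\{x\})>0)>0$. An atomless CRM $\alpha$ has drift $\gamma$ and Lévy measure $H$ (positive measures on $S$ and $S\times(0,\infty)$ with $\gamma(A)+\int_0^\infty(1\wedge x)\,H(A\times dx)<\infty$ for bounded $A\in\mathbf S$) if $\mathbb E e^{i\theta\alpha(A)}=\exp\big(i\theta\gamma(A)+\int_0^\infty(e^{i\theta x}-1)\,H(A\times dx)\big)$ for all $\theta\in\mathbb R$ and all bounded $A\in\mathbf S$. A probability law on $\mathbb R$ is quasi-infinitely divisible (QID) if its characteristic function has a Lévy–Khintchine representation with a real drift, a real Gaussian variance and a quasi-Lévy type measure, that is, a difference $\nu^+-\nu^-$ of mutually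 singular measures on $\mathbb R$ without mass at $0$ such that $\int(1\wedge x^2)\,d(\nu^++\nu^-)<\infty$. Let $\mathcal A'$ be the class of all CRMs $\xi$ on $S$ for which, almost surely, $$\xi=\alpha+\sum_{j=1}^n\beta_j\delta_{s_j},\qquad(1)$$ where $n\in\mathbb Z_+$, $\alpha$ is an atomless point process with independent increments and finite Lévy measure, $s_1,\dots,s_n\in S$ are distinct fixed atoms of $\xi$, and $\beta_1,\dots,\beta_n$ are QID random variables, each concentrated on a finite subset of $\mathbb Z_+$, which are mutually independent and independent of $\alpha$. Call a polynomial $p(w)=\sum_{l=0}^{k}a_lw^l$ admissible if $k\ge1$, $a_l\ge0$, $a_k>0$, $\sum_la_l=1$, and $p$ has no complex root of modulus $1$. Let $\zeta_1,\dots,\zeta_k$ be its complex roots with multiplicity, let $c(p)=\#\{l:|\zeta_l|<1\}$, and let $b(p)$ be the finite signed measure $$b(p)=-\sum_{m=1}^\infty\frac1m\Big(\sum_{l:|\zeta_l|<1}\zeta_l^m\Big)\delta_{-m}-\sum_{m=1}^\infty\frac1m\Big(\sum_{l:|\zeta_l|>1}\zeta_l^{-m}\Big)\delta_m .$$ Given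 distinct $s_1,\dots,s_n\in S$ and admissible $p_1,\dots,p_n$, call a pair $(\nu_0,F)$ of finite signed measures on $\mathbf S$ and on $\mathbf S\otimes\mathcal B(\mathbb R)$ explicit with data $(s_j,p_j)_{j\le n}$ if, for all $A\in\mathbf S$ and $B\in\mathcal B(\mathbb R)$, (i) $\nu_0(A)=\sum_{j=1}^n\delta_{s_j}(A)\,c(p_j)$; (ii) $F(A\times B)=\tilde G(A\times B)+\sum_{j=1}^n\delta_{s_j}(A)\,b(p_j)(B)$, where $\tilde G$ is a finite positive measure on $S\times\mathbb R$ concentrated on $S\times\mathbb N$ and with diffuse projections onto $S$, i.e. $\tilde G(\{x\}\times B)=0$ for all $x\in S$ and $B\in\mathcal B(\mathbb R)$. Say that $(\nu_0,F)$ is a characteristic pair of a random measure $\xi$ if, for every $A\in\mathbf S$, $\xi(A)<\infty$ a.s. and $$\mathbb E e^{i\theta\xi(A)}=\exp\Big(i\theta\nu_0(A)+\int_{\mathbb R}(e^{i\theta x}-1)\,F(A\times dx)\Big),\qquad\theta\in\mathbb R.$$ **Theorem.** (a) Let $\xi\in\mathcal A'$ be decomposed as in (1), and let $p_j(w)=\sum_l\mathbb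 P(\beta_j=l)\,w^l$. Then $p_1,\dots,p_n$ are admissible, and there is an explicit pair with data $(s_j,p_j)_{j\le n}$ that is a characteristic pair of $\xi$. (b) Conversely, let $s_1,\dots,s_n\in S$ be distinct, let $p_1,\dots,p_n$ be admissible, and let $(\nu_0,F)$ be an explicit pair with data $(s_j,p_j)_{j\le n}$. Then there is a random measure $\xi\in\mathcal A'$ with characteristic pair $(\nu_0,F)$, and it is unique in law: every CRM with characteristic pair $(\nu_0,F)$ has the same law as $\xi$. -/

import Mathlib

open MeasureTheory ProbabilityTheory Polynomial
open scoped ENNReal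

universe u v

namespace QIDRM

noncomputable section

/-! ### Random measures -/

section RandomMeasures

variable {S : Type u} [MetricSpace S] [MeasurableSpace S]
variable {Ω : Type v} [MeasurableSpace Ω]

/-- A random measure on `S`: a map `ξ : Ω → Measure S` such that every `ξ(B)`, `B` Borel, is a
random variable (this is what measurability for the σ-algebra on `Measure S` means) and such that
every `ξ ω` is finite on bounded Borel sets. -/
structure IsRandomMeasure (ξ : Ω → Measure S) : Prop where
  measurable : Measurable ξ
  locallyFinite : ∀ ω, ∀ A : Set S, MeasurableSet A → Bornology.IsBounded A → ξ ω A < ∞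

/-- A completely random measure: a random measure with independent values on disjoint sets. -/
structure IsCRM (P : Measure Ω) (ξ : Ω → Measure S) : Prop extends IsRandomMeasure ξ where
  indep : ∀ (k : ℕ) (B : Fin k → Set S), (∀ i, MeasurableSet (B i)) →
    Pairwise (fun i j => Disjoint (B i) (B j)) → iIndepFun (fun i ω => ξ ω (B i)) P

/-- A point process: an integer-valued random measure. -/
structure IsPointProcess (ξ : Ω → Measure S) : Prop extends IsRandomMeasure ξ where
  integerValued : ∀ ω, ∀ A : Set S, MeasurableSet A → Bornology.IsBounded A →
    ∃ m : ℕ, ξ ω A = m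

/-- A random measure without fixed atoms. -/
def IsAtomless (P : Measure Ω) (ξ : Ω → Measure S) : Prop :=
  ∀ x : S, ∀ᵐ ω ∂P, ξ ω {x} = 0

/-- `(γ, F)` is the pair of an atomless completely random measure `α`: for bounded Borel `A`,
`E exp(iθα(A)) = exp(iθγ(A) + ∫ (exp(iθx) - 1) F(A × dx))`, where `γ` (the drift) and `F` (the
Lévy measure) are positive measures on `S` and `S × (0,∞)`, with
`γ(A) + ∫ (1 ∧ x) F(A × dx) < ∞`. Here `F` is regarded as a measure on `S × ℝ`. -/
structure IsLevyPair (P : Measure Ω) (α : Ω → Measure S) (γ : Measure S)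
    (F : Measure (S × ℝ)) : Prop where
  drift_lt_top : ∀ A : Set S, MeasurableSet A → Bornology.IsBounded A → γ A < ∞
  levy_positive : ∀ᵐ z ∂F, 0 < z.2
  levy_integrable : ∀ A : Set S, MeasurableSet A → Bornology.IsBounded A →
    ∫⁻ z in A ×ˢ Set.univ, ENNReal.ofReal (min 1 z.2) ∂F < ∞
  charFun_eq : ∀ A : Set S, MeasurableSet A → Bornology.IsBounded A → ∀ θ : ℝ,
    charFun (P.map fun ω => (α ω A).toReal) θ =
      Complex.exp (Complex.I * θ * (γ A).toReal +
        ∫ z in A ×ˢ (Set.univ : Set ℝ), (Complex.exp (Complex.I * θ * z.2) - 1) ∂F)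

/-- The Lévy measure of `α` exists and is finite. -/
def HasFiniteLevyMeasure (P : Measure Ω) (α : Ω → Measure S) : Prop :=
  ∃ (γ : Measure S) (F : Measure (S × ℝ)), IsLevyPair P α γ F ∧ IsFiniteMeasure F

end RandomMeasures

/-! ### Quasi-infinitely divisible distributions -/

/-- A quasi-Lévy type measure `ν`, given by its positive part `ν⁺` and its negative part `ν⁻`
(the minimal ones, hence mutually singular). -/
structure QuasiLevyTypeMeasure where
  pos : Measure ℝ
  neg : Measure ℝ
  mutuallySingular : Measure.MutuallySingular pos neg
  pos_zero : pos {0} = 0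
  neg_zero : neg {0} = 0
  lintegral_lt_top : ∫⁻ x, ENNReal.ofReal (min 1 (x ^ 2)) ∂(pos + neg) < ∞

/-- `∫ f dν = ∫ f dν⁺ - ∫ f dν⁻`. -/
def QuasiLevyTypeMeasure.integral (ν : QuasiLevyTypeMeasure) (f : ℝ → ℂ) : ℂ :=
  ∫ x, f x ∂ν.pos - ∫ x, f x ∂ν.neg

/-- The centering function `τ(x) = x 1_{[-1,1]}(x)`. -/
def centering (x : ℝ) : ℝ := Set.indicator (Set.Icc (-1) 1) (fun y => y) x

/-- `μ` is quasi-infinitely divisible: its characteristic function has a Lévy-Khintchine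
representation with a quasi-Lévy type measure. The choice of the centering function only affects
the drift. -/
def IsQID (μ : Measure ℝ) : Prop :=
  ∃ (drift gaussVar : ℝ) (ν : QuasiLevyTypeMeasure), ∀ θ : ℝ,
    charFun μ θ = Complex.exp (Complex.I * θ * drift - (θ : ℂ) ^ 2 / 2 * gaussVar +
      ν.integral fun x =>
        Complex.exp (Complex.I * θ * x) - 1 - Complex.I * θ * (centering x : ℝ))

/-! ### The class of point processes under consideration -/

section TheClass

variable {S : Type u} [MetricSpace S] [MeasurableSpace S]
variable {Ω : Type v} [MeasurableSpace Ω]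

/-- `ξ = α + ∑ j, β j • δ_{s j}` almost surely, where `α` is an atomless point process with
independent increments and finite Lévy measure, `s 0, …, s (n-1)` are distinct fixed atoms of `ξ`,
and the `β j` are quasi-infinitely divisible random variables, each concentrated on a finite set
of nonnegative integers, which are mutually independent and independent of `α`. -/
structure IsDecomposition (P : Measure Ω) (ξ : Ω → Measure S) {n : ℕ} (α : Ω → Measure S)
    (s : Fin n → S) (β : Fin n → Ω → ℝ) : Prop where
  crm : IsCRM P α
  pointProcess : IsPointProcess α
  atomless : IsAtomless P α
  finiteLevy : HasFiniteLevyMeasure P α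
  injective : Function.Injective s
  fixedAtom : ∀ j, 0 < P {ω | 0 < ξ ω {s j}}
  measurable : ∀ j, Measurable (β j)
  qid : ∀ j, IsQID (P.map (β j))
  finiteSupport : ∀ j, ∃ T : Finset ℕ, ∀ᵐ ω ∂P, ∃ l ∈ T, β j ω = l
  indep : iIndepFun β P
  indep_atomless : IndepFun α (fun ω j => β j ω) P
  eq_ae : ∀ᵐ ω ∂P, ξ ω = α ω + ∑ j, ENNReal.ofReal (β j ω) • Measure.dirac (s j)

/-- The class `𝒜'` of completely random measures which admit a decomposition as above. -/
def MemClass (P : Measure Ω) (ξ : Ω → Measure S) : Prop :=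
  IsCRM P ξ ∧ ∃ (n : ℕ) (α : Ω → Measure S) (s : Fin n → S) (β : Fin n → Ω → ℝ),
    IsDecomposition P ξ α s β

end TheClass

/-! ### The Lévy-Khintchine formula of a random measure -/

section LevyKhintchine

variable {S : Type u} [MeasurableSpace S]

/-- The signed measure `F_A(B) = F(A × B)` on `ℝ`. -/
def fiber (F : SignedMeasure (S × ℝ)) (A : Set S) : SignedMeasure ℝ :=
  (F.restrict (A ×ˢ Set.univ)).map Prod.snd

theorem fiber_apply (F : SignedMeasure (S × ℝ)) {A : Set S} (hA : MeasurableSet A) {B : Set ℝ}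
    (hB : MeasurableSet B) : fiber F A B = F (A ×ˢ B) := by
  rw [fiber, VectorMeasure.map_apply _ measurable_snd hB,
    VectorMeasure.restrict_apply _ (hA.prod MeasurableSet.univ) (measurable_snd hB)]
  congr 1
  ext z
  simp [and_comm]

/-- `∫ f dμ = ∫ f dμ⁺ - ∫ f dμ⁻` for the Jordan decomposition `μ = μ⁺ - μ⁻`. -/
def signedIntegral (μ : SignedMeasure ℝ) (f : ℝ → ℂ) : ℂ :=
  ∫ x, f x ∂μ.toJordanDecomposition.posPart - ∫ x, f x ∂μ.toJordanDecomposition.negPart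

/-- For every Borel set `A`, `ξ(A)` is almost surely finite and
`E exp(iθξ(A)) = exp(iθν₀(A) + ∫ (exp(iθx) - 1) F_A(dx))` for all `θ`. -/
def HasLevyKhintchine {Ω : Type v} [MeasurableSpace Ω] (P : Measure Ω) (ξ : Ω → Measure S)
    (ν₀ : SignedMeasure S) (F : SignedMeasure (S × ℝ)) : Prop :=
  ∀ A : Set S, MeasurableSet A → (∀ᵐ ω ∂P, ξ ω A < ∞) ∧
    ∀ θ : ℝ, charFun (P.map fun ω => (ξ ω A).toReal) θ =
      Complex.exp (Complex.I * θ * (ν₀ A : ℝ) +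
        signedIntegral (fiber F A) fun x => Complex.exp (Complex.I * θ * x) - 1)

/-! ### The explicit pairs -/

/-- `p(w) = ∑ a_l w^l` is the generating polynomial of a probability distribution on
`{0, …, k}`, `k = deg p ≥ 1`, and has no root on the unit circle. -/
structure IsWeightPolynomial (p : ℝ[X]) : Prop where
  coeff_nonneg : ∀ l, 0 ≤ p.coeff l
  eval_one : p.eval 1 = 1
  natDegree_pos : 1 ≤ p.natDegree
  no_unit_root : ∀ w : ℂ, ‖w‖ = 1 → aeval w p ≠ 0

open Classical in
/-- The multiset of the complex roots of `p` inside the open unit disc. -/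
def innerRoots (p : ℝ[X]) : Multiset ℂ := (p.aroots ℂ).filter fun ζ => ‖ζ‖ < 1

open Classical in
/-- The multiset of the complex roots of `p` outside the closed unit disc. -/
def outerRoots (p : ℝ[X]) : Multiset ℂ := (p.aroots ℂ).filter fun ζ => 1 < ‖ζ‖

/-- `δ_x(A)`. -/
def diracValue {X : Type*} (x : X) (A : Set X) : ℝ := Set.indicator A (fun _ => 1) x

/-- The root formula
`b = - ∑_{m ≥ 1} m⁻¹ (∑_{|ζ| < 1} ζ^m) δ_{-m} - ∑_{m ≥ 1} m⁻¹ (∑_{|ζ| > 1} ζ^{-m}) δ_m`,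
the sums running over the complex roots `ζ` of `p` counted with multiplicity. The summation index
`i` below stands for `m - 1`. -/
def IsRootMeasure (p : ℝ[X]) (b : SignedMeasure ℝ) : Prop :=
  ∀ B : Set ℝ, MeasurableSet B →
    HasSum (fun i : ℕ =>
      -(((i + 1 : ℕ) : ℂ)⁻¹ * ((innerRoots p).map fun ζ => ζ ^ (i + 1)).sum *
          (diracValue (-((i + 1 : ℕ) : ℝ)) B : ℝ))
        - ((i + 1 : ℕ) : ℂ)⁻¹ * ((outerRoots p).map fun ζ => (ζ⁻¹) ^ (i + 1)).sum *
          (diracValue ((i + 1 : ℕ) : ℝ) B : ℝ))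
      ((b B : ℝ) : ℂ)

/-- The pair `(ν₀, F)` is explicit, with distinct atoms `s j` and weight polynomials `p j`:
`ν₀ = ∑ j, c_j δ_{s j}`, where `c_j` is the number of roots of `p j` inside the unit disc, and
`F(A × B) = G(A × B) + ∑ j, δ_{s j}(A) b_j(B)`, where `G` is a finite measure concentrated on
`S × {1, 2, …}`, with diffuse projections onto `S`, and `b_j` is given by the root formula. -/
def IsExplicitPair (ν₀ : SignedMeasure S) (F : SignedMeasure (S × ℝ)) {n : ℕ} (s : Fin n → S)
    (p : Fin n → ℝ[X]) : Prop :=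
  Function.Injective s ∧ (∀ j, IsWeightPolynomial (p j)) ∧
  (∀ A : Set S, MeasurableSet A →
    ν₀ A = ∑ j, diracValue (s j) A * ((innerRoots (p j)).card : ℝ)) ∧
  ∃ (G : Measure (S × ℝ)) (b : Fin n → SignedMeasure ℝ),
    IsFiniteMeasure G ∧
    (∀ᵐ z ∂G, ∃ m : ℕ, 1 ≤ m ∧ z.2 = (m : ℝ)) ∧
    (∀ x : S, ∀ B : Set ℝ, MeasurableSet B → G ({x} ×ˢ B) = 0) ∧
    (∀ j, IsRootMeasure (p j) (b j)) ∧
    ∀ (A : Set S) (B : Set ℝ), MeasurableSet A → MeasurableSet B →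
      F (A ×ˢ B) = (G (A ×ˢ B)).toReal + ∑ j, diracValue (s j) A * b j B

end LevyKhintchine

end

end QIDRM

open QIDRM

/-!
Everything is read off from characteristic functions.

A weight polynomial factors over its roots. On the unit circle `|w| = 1` a root `ζ` contributes
`(w - ζ) / (1 - ζ)`, which is `w (1 - ζ w⁻¹) / (1 - ζ)` inside the disc and
`(1 - ζ⁻¹ w) / (1 - ζ⁻¹)` outside. Expanding the logarithms of these factors gives the number of
inner roots as drift and the root measure as signed Lévy measure: `p (e^{iθ}) = exp (iθ c(p) + ∫
(e^{iθx} - 1) b(p)(dx))`, which is `IsRootMeasure.aeval_exp_eq`.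

For a member of the class, the fixed atoms therefore contribute the discrete part of the pair; the
absence of roots on the circle holds because the characteristic function of a quasi-infinitely
divisible law has no zero. The atomless part `α` contributes its Lévy measure: since `α` is
integer-valued, its characteristic function is `1` at `2π`, which forces the Lévy measure to live on
integers and the drift to be integer-valued (`IsLevyPair.integer_of_integerValued`); a diffuse
integer-valued drift vanishes (`IsLevyPair.drift_eq_zero`). Finiteness of the Lévy measure together
with the Borel-Cantelli lemma makes `α` a finite measure almost surely
(`IsLevyPair.ae_univ_lt_top`), so that the Lévy-Khintchine formula extends from bounded sets to all
Borel sets.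

Conversely, the diffuse part `G` of an explicit pair is the intensity of a Poisson cluster process,
built from `∑ N, exp (-G X) / N! • G^N` on finite sequences (`poissonLaw`), and independent
variables with generating polynomials `p j` are added at the points `s j`
(`exists_isDecomposition`).
Uniqueness holds since the pair determines the one-dimensional laws, and for a completely random
measure these determine the joint law of its values on the atoms of any finite partition, hence the
law itself (`IsCRM.map_eq`).
-/

namespace QIDRM

/-! ### Integration against signed measures -/

/-- The measure `∑ i, w_i⁺ δ_{x i}`. -/
noncomputable def atomicMeasure (w x : ℕ → ℝ) : Measure ℝ :=
  Measure.sum fun i => ENNReal.ofReal (w i) • Measure.dirac (x i)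

theorem isFiniteMeasure_atomicMeasure {w : ℕ → ℝ} (hw : Summable fun i => |w i|) (x : ℕ → ℝ) :
    IsFiniteMeasure (atomicMeasure w x) := by
  refine ⟨?_⟩
  rw [atomicMeasure, Measure.sum_apply _ MeasurableSet.univ]
  simp only [Measure.smul_apply, measure_univ, smul_eq_mul, mul_one]
  refine lt_of_le_of_lt (ENNReal.tsum_le_tsum fun i => ENNReal.ofReal_le_ofReal (le_abs_self _)) ?_
  rw [← ENNReal.ofReal_tsum_of_nonneg (fun i => abs_nonneg _) hw]
  exact ENNReal.ofReal_lt_top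

theorem hasSum_integral_atomicMeasure {E : Type*} [NormedAddCommGroup E] [NormedSpace ℝ E]
    [CompleteSpace E] {w : ℕ → ℝ} (hw : Summable fun i => |w i|) (x : ℕ → ℝ) {f : ℝ → E}
    (hf : StronglyMeasurable f) {C : ℝ} (hC : ∀ t, ‖f t‖ ≤ C) :
    HasSum (fun i => max (w i) 0 • f (x i)) (∫ t, f t ∂atomicMeasure w x) := by
  have := isFiniteMeasure_atomicMeasure hw x
  have hi : Integrable f (atomicMeasure w x) :=
    Integrable.of_bound hf.aestronglyMeasurable C (.of_forall hC)
  have h := hasSum_integral_measure (μ := fun i => ENNReal.ofReal (w i) • Measure.dirac (x i)) hi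
  simpa [atomicMeasure, integral_smul_measure, integral_dirac, ENNReal.toReal_ofReal'] using h

theorem signedIntegral_toSignedMeasure_sub (μ ν : Measure ℝ) [IsFiniteMeasure μ]
    [IsFiniteMeasure ν] {f : ℝ → ℂ} (hf : StronglyMeasurable f) {C : ℝ} (hC : ∀ t, ‖f t‖ ≤ C) :
    signedIntegral (μ.toSignedMeasure - ν.toSignedMeasure) f = ∫ t, f t ∂μ - ∫ t, f t ∂ν := by
  set b := μ.toSignedMeasure - ν.toSignedMeasure with hb
  set J := b.toJordanDecomposition with hJ
  have hint : ∀ (ρ : Measure ℝ) [IsFiniteMeasure ρ], Integrable f ρ := fun ρ _ =>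
    Integrable.of_bound hf.aestronglyMeasurable C (.of_forall hC)
  have h1 : J.posPart.toSignedMeasure - J.negPart.toSignedMeasure = b :=
    SignedMeasure.toSignedMeasure_toJordanDecomposition b
  have h2 : J.posPart + ν = μ + J.negPart := by
    rw [← Measure.toSignedMeasure_eq_toSignedMeasure_iff, Measure.toSignedMeasure_add,
      Measure.toSignedMeasure_add, ← sub_eq_sub_iff_add_eq_add]
    rw [h1]
  have h3 : ∫ t, f t ∂J.posPart + ∫ t, f t ∂ν = ∫ t, f t ∂μ + ∫ t, f t ∂J.negPart := by
    rw [← integral_add_measure (hint _) (hint _), ← integral_add_measure (hint _) (hint _), h2]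
  rw [signedIntegral, ← hJ]
  linear_combination h3

theorem signedIntegral_add (b c : SignedMeasure ℝ) {f : ℝ → ℂ} (hf : StronglyMeasurable f) {C : ℝ}
    (hC : ∀ t, ‖f t‖ ≤ C) : signedIntegral (b + c) f = signedIntegral b f + signedIntegral c f := by
  have hint : ∀ (ρ : Measure ℝ) [IsFiniteMeasure ρ], Integrable f ρ := fun ρ _ =>
    Integrable.of_bound hf.aestronglyMeasurable C (.of_forall hC)
  set J := b.toJordanDecomposition with hJ
  set K := c.toJordanDecomposition with hK
  have h : b + c = (J.posPart + K.posPart).toSignedMeasure -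
      (J.negPart + K.negPart).toSignedMeasure := by
    have h1 : J.posPart.toSignedMeasure - J.negPart.toSignedMeasure = b :=
      SignedMeasure.toSignedMeasure_toJordanDecomposition b
    have h2 : K.posPart.toSignedMeasure - K.negPart.toSignedMeasure = c :=
      SignedMeasure.toSignedMeasure_toJordanDecomposition c
    rw [Measure.toSignedMeasure_add, Measure.toSignedMeasure_add, ← h1, ← h2]
    abel
  rw [h, signedIntegral_toSignedMeasure_sub _ _ hf hC, integral_add_measure (hint _) (hint _),
    integral_add_measure (hint _) (hint _), signedIntegral, signedIntegral]
  ring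

theorem signedIntegral_zero (f : ℝ → ℂ) : signedIntegral 0 f = 0 := by
  rw [signedIntegral, SignedMeasure.toJordanDecomposition_zero, JordanDecomposition.zero_posPart,
    JordanDecomposition.zero_negPart, sub_self]

theorem signedIntegral_sum {ι : Type*} (t : Finset ι) (b : ι → SignedMeasure ℝ) {f : ℝ → ℂ}
    (hf : StronglyMeasurable f) {C : ℝ} (hC : ∀ t, ‖f t‖ ≤ C) :
    signedIntegral (∑ j ∈ t, b j) f = ∑ j ∈ t, signedIntegral (b j) f := by
  classical
  induction t using Finset.induction_on with
  | empty => simp [signedIntegral_zero]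
  | insert j t hj ih =>
    rw [Finset.sum_insert hj, Finset.sum_insert hj, signedIntegral_add _ _ hf hC, ih]

theorem signedIntegral_toSignedMeasure (μ : Measure ℝ) [IsFiniteMeasure μ] {f : ℝ → ℂ}
    (hf : StronglyMeasurable f) {C : ℝ} (hC : ∀ t, ‖f t‖ ≤ C) :
    signedIntegral μ.toSignedMeasure f = ∫ t, f t ∂μ := by
  have h := signedIntegral_toSignedMeasure_sub μ 0 hf hC
  simpa using h

/-- An absolutely summable family of point masses is a signed measure. -/
theorem exists_atomic_signedMeasure {w : ℕ → ℝ} (hw : Summable fun i => |w i|) (x : ℕ → ℝ) :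
    ∃ b : SignedMeasure ℝ,
      (∀ B, MeasurableSet B → HasSum (fun i => w i * diracValue (x i) B) (b B)) ∧
      ∀ (f : ℝ → ℂ) (C : ℝ), StronglyMeasurable f → (∀ t, ‖f t‖ ≤ C) →
        HasSum (fun i => (w i : ℂ) * f (x i)) (signedIntegral b f) := by
  have hw' : Summable fun i => |(-w) i| := by simpa using hw
  have := isFiniteMeasure_atomicMeasure hw x
  have := isFiniteMeasure_atomicMeasure hw' x
  have hmax : ∀ t : ℝ, max t 0 - max (-t) 0 = t := fun t => by
    rcases le_total t 0 with h | h
    · rw [max_eq_right h, max_eq_left (by linarith)]; ring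
    · rw [max_eq_left h, max_eq_right (by linarith)]; ring
  refine ⟨(atomicMeasure w x).toSignedMeasure - (atomicMeasure (-w) x).toSignedMeasure, ?_, ?_⟩
  · intro B hB
    have hs : StronglyMeasurable (Set.indicator B fun _ => (1 : ℝ)) :=
      stronglyMeasurable_const.indicator hB
    have hC : ∀ t, ‖Set.indicator B (fun _ => (1 : ℝ)) t‖ ≤ 1 := fun t => by
      by_cases ht : t ∈ B <;> simp [ht]
    have h := (hasSum_integral_atomicMeasure hw x hs hC).sub
      (hasSum_integral_atomicMeasure hw' x hs hC)
    rw [Measure.toSignedMeasure_sub_apply hB]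
    rw [integral_indicator_const _ hB, integral_indicator_const _ hB] at h
    simp only [smul_eq_mul, mul_one] at h
    have e : ∀ i, w i * diracValue (x i) B = max (w i) 0 * B.indicator (fun _ => 1) (x i) -
        max ((-w) i) 0 * B.indicator (fun _ => 1) (x i) := fun i => by
      rw [diracValue, ← sub_mul, Pi.neg_apply, hmax]
    simp only [e]
    exact h
  · intro f C hf hC
    have h := (hasSum_integral_atomicMeasure hw x hf hC).sub
      (hasSum_integral_atomicMeasure hw' x hf hC)
    rw [signedIntegral_toSignedMeasure_sub _ _ hf hC]
    have e : ∀ i, (w i : ℂ) * f (x i) = max (w i) 0 • f (x i) - max ((-w) i) 0 • f (x i) :=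
      fun i => by rw [← sub_smul, Pi.neg_apply, hmax, Complex.real_smul]
    simp only [e]
    exact h

section Fiber

variable {S : Type u} [MeasurableSpace S]

open Classical in
theorem signedIntegral_fiber {F : SignedMeasure (S × ℝ)} {n : ℕ} {s : Fin n → S}
    {G : Measure (S × ℝ)} [IsFiniteMeasure G] {b : Fin n → SignedMeasure ℝ}
    (hF : ∀ (A : Set S) (B : Set ℝ), MeasurableSet A → MeasurableSet B →
      F (A ×ˢ B) = (G (A ×ˢ B)).toReal + ∑ j, diracValue (s j) A * b j B)
    {A : Set S} (hA : MeasurableSet A) {f : ℝ → ℂ} (hf : StronglyMeasurable f) {C : ℝ}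
    (hC : ∀ t, ‖f t‖ ≤ C) :
    signedIntegral (fiber F A) f = ∫ z in A ×ˢ (Set.univ : Set ℝ), f z.2 ∂G +
      ∑ j, if s j ∈ A then signedIntegral (b j) f else 0 := by
  have hfib : fiber F A = ((G.restrict (A ×ˢ Set.univ)).map Prod.snd).toSignedMeasure +
      ∑ j, if s j ∈ A then b j else 0 := by
    ext B hB
    rw [fiber_apply F hA hB, hF A B hA hB, _root_.add_apply,
      Measure.toSignedMeasure_apply_measurable hB, measureReal_def,
      Measure.map_apply measurable_snd hB, Measure.restrict_apply (measurable_snd hB),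
      FunLike.coe_sum, Finset.sum_apply]
    congr 1
    · congr 2
      ext z
      simp [and_comm]
    · refine Finset.sum_congr rfl fun j _ => ?_
      by_cases hj : s j ∈ A <;> simp [diracValue, hj]
  rw [hfib, signedIntegral_add _ _ hf hC, signedIntegral_sum _ _ hf hC,
    signedIntegral_toSignedMeasure _ hf hC,
    integral_map measurable_snd.aemeasurable hf.aestronglyMeasurable]
  congr 1
  refine Finset.sum_congr rfl fun j _ => ?_
  by_cases hj : s j ∈ A <;> simp [hj, signedIntegral_zero]

end Fiber

/-! ### The root formula -/

theorem norm_exp_I_mul (θ x : ℝ) : ‖Complex.exp (Complex.I * θ * x)‖ = 1 := by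
  rw [mul_assoc, mul_comm, ← Complex.ofReal_mul, Complex.norm_exp_ofReal_mul_I]

theorem norm_exp_I_mul_sub_one_le (θ x : ℝ) : ‖Complex.exp (Complex.I * θ * x) - 1‖ ≤ 2 := by
  refine (norm_sub_le _ _).trans ?_
  rw [norm_exp_I_mul, norm_one]
  norm_num

theorem stronglyMeasurable_exp_I_mul_sub_one (θ : ℝ) :
    StronglyMeasurable fun x : ℝ => Complex.exp (Complex.I * θ * x) - 1 := by
  have : Continuous fun x : ℝ => Complex.exp (Complex.I * θ * x) - 1 := by fun_prop
  exact this.stronglyMeasurable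

theorem hasSum_multiset_sum {ι : Type*} (M : Multiset ι) {f : ι → ℕ → ℂ} {g : ι → ℂ}
    (h : ∀ a ∈ M, HasSum (f a) (g a)) :
    HasSum (fun i => (M.map fun a => f a i).sum) (M.map g).sum := by
  induction M using Multiset.induction_on with
  | empty => simp
  | cons a M ih =>
    simp only [Multiset.map_cons, Multiset.sum_cons]
    exact (h a (Multiset.mem_cons_self a M)).add
      (ih fun c hc => h c (Multiset.mem_cons_of_mem hc))

/-- The logarithmic series, summed over a multiset of points of the open unit disc. -/
theorem hasSum_log_multiset {M : Multiset ℂ} (hM : ∀ ζ ∈ M, ‖ζ‖ < 1) {w : ℂ} (hw : ‖w‖ = 1) :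
    HasSum (fun i : ℕ => ((i + 1 : ℕ) : ℂ)⁻¹ * (M.map fun ζ => ζ ^ (i + 1)).sum * w ^ (i + 1))
      (M.map fun ζ => -Complex.log (1 - ζ * w)).sum := by
  have h : ∀ ζ ∈ M, HasSum (fun i : ℕ => ((i + 1 : ℕ) : ℂ)⁻¹ * ζ ^ (i + 1) * w ^ (i + 1))
      (-Complex.log (1 - ζ * w)) := fun ζ hζ => by
    have h1 := Complex.hasSum_taylorSeries_neg_log (z := ζ * w)
      (by rw [norm_mul, hw, mul_one]; exact hM ζ hζ)
    have h2 := (hasSum_nat_add_iff' 1).mpr h1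
    simp only [Finset.range_one, Finset.sum_singleton, pow_zero, Nat.cast_zero, div_zero,
      sub_zero] at h2
    have e : ∀ i : ℕ, ((i + 1 : ℕ) : ℂ)⁻¹ * ζ ^ (i + 1) * w ^ (i + 1) =
        (ζ * w) ^ (i + 1) / ((i + 1 : ℕ) : ℂ) := fun i => by
      rw [mul_pow, div_eq_mul_inv]; ring
    simp only [e]
    exact h2
  have h3 := hasSum_multiset_sum M h
  simp only [Multiset.sum_map_mul_left, Multiset.sum_map_mul_right] at h3
  exact h3

theorem exp_log_multiset {M : Multiset ℂ} (hM : ∀ ζ ∈ M, ‖ζ‖ < 1) {w : ℂ} (hw : ‖w‖ = 1) :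
    Complex.exp (M.map fun ζ => -Complex.log (1 - ζ * w)).sum =
      ((M.map fun ζ => 1 - ζ * w).prod)⁻¹ := by
  rw [Complex.exp_multiset_sum, Multiset.map_map, ← Multiset.prod_map_inv]
  refine congrArg _ (Multiset.map_congr rfl fun ζ hζ => ?_)
  have : 1 - ζ * w ≠ 0 := fun h => by
    have h1 : ζ * w = 1 := (sub_eq_zero.mp h).symm
    have h2 : ‖ζ‖ = 1 := by
      have := congrArg norm h1
      rwa [norm_mul, hw, mul_one, norm_one] at this
    exact absurd h2 (hM ζ hζ).ne
  rw [Function.comp_apply, Complex.exp_neg, Complex.exp_log this]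

theorem aroots_map_conj (p : ℝ[X]) : (p.aroots ℂ).map (starRingEnd ℂ) = p.aroots ℂ := by
  rw [aroots_def, ← (IsAlgClosed.splits _).roots_map, Polynomial.map_map]
  congr 2
  ext x
  simp

/-- Power sums over a conjugation-invariant multiset are real. -/
theorem ofReal_re_sum_pow_of_map_conj {M : Multiset ℂ} (hM : M.map (starRingEnd ℂ) = M)
    (m : ℕ) : ((((M.map fun ζ => ζ ^ m).sum).re : ℝ) : ℂ) = (M.map fun ζ => ζ ^ m).sum := by
  rw [← Complex.conj_eq_iff_re, map_multiset_sum, Multiset.map_map]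
  conv_rhs => rw [← hM, Multiset.map_map]
  simp

theorem innerRoots_map_conj (p : ℝ[X]) : (innerRoots p).map (starRingEnd ℂ) = innerRoots p := by
  classical
  conv_rhs => rw [innerRoots, ← aroots_map_conj p, Multiset.filter_map]
  simp [innerRoots]

theorem outerRoots_map_conj (p : ℝ[X]) : (outerRoots p).map (starRingEnd ℂ) = outerRoots p := by
  classical
  conv_rhs => rw [outerRoots, ← aroots_map_conj p, Multiset.filter_map]
  simp [outerRoots]

theorem outerRoots_map_inv_map_conj (p : ℝ[X]) :
    ((outerRoots p).map fun ζ => ζ⁻¹).map (starRingEnd ℂ) = (outerRoots p).map fun ζ => ζ⁻¹ := by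
  conv_rhs => rw [← outerRoots_map_conj p]
  simp [Multiset.map_map]

theorem norm_lt_one_of_mem_innerRoots {p : ℝ[X]} {ζ : ℂ} (h : ζ ∈ innerRoots p) : ‖ζ‖ < 1 := by
  classical
  exact (Multiset.mem_filter.mp h).2

theorem norm_lt_one_of_mem_outerRoots_inv {p : ℝ[X]} {ζ : ℂ}
    (h : ζ ∈ (outerRoots p).map fun ζ => ζ⁻¹) : ‖ζ‖ < 1 := by
  classical
  obtain ⟨z, hz, rfl⟩ := Multiset.mem_map.mp h
  have := (Multiset.mem_filter.mp hz).2
  rw [norm_inv]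
  exact inv_lt_one_of_one_lt₀ this

theorem IsWeightPolynomial.ne_zero {p : ℝ[X]} (hp : IsWeightPolynomial p) : p ≠ 0 := fun h => by
  have := hp.natDegree_pos
  simp [h] at this

theorem IsWeightPolynomial.innerRoots_add_outerRoots {p : ℝ[X]} (hp : IsWeightPolynomial p) :
    innerRoots p + outerRoots p = p.aroots ℂ := by
  classical
  conv_rhs => rw [← Multiset.filter_add_not (fun ζ : ℂ => ‖ζ‖ < 1) (p.aroots ℂ)]
  rw [innerRoots, outerRoots]
  congr 1
  refine Multiset.filter_congr fun ζ hζ => ?_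
  have h0 : aeval ζ p = 0 := (mem_aroots.mp hζ).2
  have h1 : ‖ζ‖ ≠ 1 := fun h => hp.no_unit_root ζ h h0
  rw [not_lt]
  exact ⟨le_of_lt, fun h => lt_of_le_of_ne h h1.symm⟩

/-- A weight polynomial on the unit circle, as a product over its roots. Each root `ζ` contributes
`(w - ζ) / (1 - ζ)`, written as `w (1 - ζ w⁻¹) / (1 - ζ)` when `ζ` is an inner root and as
`(1 - ζ⁻¹ w) / (1 - ζ⁻¹)` when it is an outer root. -/
theorem IsWeightPolynomial.aeval_eq_prod {p : ℝ[X]} (hp : IsWeightPolynomial p) {w : ℂ}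
    (hw : ‖w‖ = 1) :
    aeval w p = w ^ (innerRoots p).card *
      (((innerRoots p).map fun ζ => 1 - ζ * w⁻¹).prod *
        ((innerRoots p).map fun ζ => 1 - ζ * 1).prod⁻¹) *
      ((((outerRoots p).map fun ζ => ζ⁻¹).map fun ζ => 1 - ζ * w).prod *
        (((outerRoots p).map fun ζ => ζ⁻¹).map fun ζ => 1 - ζ * 1).prod⁻¹) := by
  have hw0 : w ≠ 0 := norm_ne_zero_iff.mp (by rw [hw]; norm_num)
  have key : ∀ z : ℂ, aeval z p =
      (p.leadingCoeff : ℂ) * (((innerRoots p).map fun ζ => z - ζ).prod *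
        ((outerRoots p).map fun ζ => z - ζ).prod) := fun z => by
    rw [← Multiset.prod_add, ← Multiset.map_add, hp.innerRoots_add_outerRoots]
    have := (IsAlgClosed.splits (p.map (algebraMap ℝ ℂ))).eval_eq_prod_roots z
    rw [eval_map_algebraMap, leadingCoeff_map] at this
    exact this
  have hin : ∀ z : ℂ, z ≠ 0 → ((innerRoots p).map fun ζ => z - ζ).prod =
      z ^ (innerRoots p).card * ((innerRoots p).map fun ζ => 1 - ζ * z⁻¹).prod := fun z hz => by
    rw [← Multiset.card_map (fun _ => z) (innerRoots p), ← Multiset.prod_replicate,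
      Multiset.card_map, ← Multiset.map_const', ← Multiset.prod_map_mul]
    refine congrArg _ (Multiset.map_congr rfl fun ζ _ => ?_)
    field_simp
  have hout : ∀ z : ℂ, ((outerRoots p).map fun ζ => z - ζ).prod =
      ((outerRoots p).map fun ζ => -ζ).prod *
        (((outerRoots p).map fun ζ => ζ⁻¹).map fun ζ => 1 - ζ * z).prod := fun z => by
    rw [Multiset.map_map, ← Multiset.prod_map_mul]
    refine congrArg _ (Multiset.map_congr rfl fun ζ hζ => ?_)
    have hζ0 : ζ ≠ 0 := fun h => by
      classical
      have := (Multiset.mem_filter.mp hζ).2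
      rw [h, norm_zero] at this
      linarith
    simp only [Function.comp_apply]
    field_simp
    ring
  have h1 : aeval (1 : ℂ) p = 1 := by
    have := hp.eval_one
    rw [← map_one (algebraMap ℝ ℂ), aeval_algebraMap_apply, aeval_def, Algebra.algebraMap_self,
      eval₂_id, this]
  have hp1 := key 1
  rw [h1, hin 1 one_ne_zero, hout 1, one_pow, one_mul, inv_one] at hp1
  rw [key w, hin w hw0, hout w]
  set L : ℂ := (p.leadingCoeff : ℂ)
  set a := ((innerRoots p).map fun ζ => 1 - ζ * 1).prod
  set c := (((outerRoots p).map fun ζ => ζ⁻¹).map fun ζ => 1 - ζ * 1).prod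
  set d := ((outerRoots p).map fun ζ => -ζ).prod
  have ha : a ≠ 0 := by
    rintro h; rw [h] at hp1; simp at hp1
  have hc : c ≠ 0 := by
    rintro h; rw [h] at hp1; simp at hp1
  -- `p(1) = 1` determines the leading coefficient
  have hLd : L * d = a⁻¹ * c⁻¹ := by
    rw [← mul_inv, ← one_div, eq_div_iff (mul_ne_zero ha hc)]
    linear_combination -hp1
  linear_combination (w ^ (innerRoots p).card *
    ((innerRoots p).map fun ζ => 1 - ζ * w⁻¹).prod *
    (((outerRoots p).map fun ζ => ζ⁻¹).map fun ζ => 1 - ζ * w).prod) * hLd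

theorem IsRootMeasure.unique {p : ℝ[X]} {b c : SignedMeasure ℝ} (hb : IsRootMeasure p b)
    (hc : IsRootMeasure p c) : b = c := by
  ext B hB
  exact Complex.ofReal_injective ((hb B hB).unique (hc B hB))

theorem IsWeightPolynomial.exists_rootMeasure {p : ℝ[X]} (hp : IsWeightPolynomial p) :
    ∃ b : SignedMeasure ℝ, IsRootMeasure p b ∧ ∀ θ : ℝ,
      aeval (Complex.exp (Complex.I * θ)) p =
        Complex.exp (Complex.I * θ * ((innerRoots p).card : ℝ) +
          signedIntegral b fun x => Complex.exp (Complex.I * θ * x) - 1) := by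
  set M := innerRoots p with hMdef
  set N := (outerRoots p).map fun ζ => ζ⁻¹ with hNdef
  have hM : ∀ ζ ∈ M, ‖ζ‖ < 1 := fun ζ h => norm_lt_one_of_mem_innerRoots h
  have hN : ∀ ζ ∈ N, ‖ζ‖ < 1 := fun ζ h => norm_lt_one_of_mem_outerRoots_inv h
  have hMs := fun m => ofReal_re_sum_pow_of_map_conj (innerRoots_map_conj p) m
  have hNs := fun m => ofReal_re_sum_pow_of_map_conj (outerRoots_map_inv_map_conj p) m
  rw [← hMdef] at hMs
  rw [← hNdef] at hNs
  have hNpow : ∀ m, ((outerRoots p).map fun ζ => (ζ⁻¹) ^ m).sum = (N.map fun ζ => ζ ^ m).sum :=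
    fun m => by rw [hNdef, Multiset.map_map]; rfl
  let coef : Multiset ℂ → ℕ → ℝ := fun K i =>
    -(((i + 1 : ℕ) : ℝ)⁻¹ * ((K.map fun ζ => ζ ^ (i + 1)).sum).re)
  have hsummable : ∀ K : Multiset ℂ, (∀ ζ ∈ K, ‖ζ‖ < 1) → Summable fun i => |coef K i| := by
    intro K hK
    have h := (Complex.hasSum_re (hasSum_log_multiset hK norm_one)).summable.neg
    rw [summable_abs_iff]
    refine h.congr fun i => ?_
    rw [one_pow, mul_one, ← Complex.ofReal_natCast, ← Complex.ofReal_inv, Complex.re_ofReal_mul]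
  obtain ⟨b, hb, hbf⟩ := exists_atomic_signedMeasure (hsummable M hM) fun i => -((i + 1 : ℕ) : ℝ)
  obtain ⟨c, hc, hcf⟩ := exists_atomic_signedMeasure (hsummable N hN) fun i => ((i + 1 : ℕ) : ℝ)
  have hcM : ∀ i, (coef M i : ℂ) = -(((i + 1 : ℕ) : ℂ)⁻¹ * (M.map fun ζ => ζ ^ (i + 1)).sum) :=
    fun i => by rw [← hMs]; simp only [coef]; push_cast; rfl
  have hcN : ∀ i, (coef N i : ℂ) = -(((i + 1 : ℕ) : ℂ)⁻¹ * (N.map fun ζ => ζ ^ (i + 1)).sum) :=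
    fun i => by rw [← hNs]; simp only [coef]; push_cast; rfl
  refine ⟨b + c, ?_, ?_⟩
  · intro B hB
    have h := (Complex.hasSum_ofReal.mpr (hb B hB)).add (Complex.hasSum_ofReal.mpr (hc B hB))
    rw [_root_.add_apply, Complex.ofReal_add]
    convert h using 2 with i
    rw [Complex.ofReal_mul, Complex.ofReal_mul, hcM, hcN, hNpow]
    ring
  · intro θ
    set w := Complex.exp (Complex.I * θ) with hw
    have hw1 : ‖w‖ = 1 := by
      have := norm_exp_I_mul θ 1
      rwa [Complex.ofReal_one, mul_one] at this
    have hw2 : ‖w⁻¹‖ = 1 := by rw [norm_inv, hw1, inv_one]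
    have hsm := stronglyMeasurable_exp_I_mul_sub_one θ
    have hbd := norm_exp_I_mul_sub_one_le θ
    have hpow : ∀ i : ℕ, Complex.exp (Complex.I * θ * (((i + 1 : ℕ) : ℝ) : ℂ)) = w ^ (i + 1) :=
      fun i => by rw [hw, ← Complex.exp_nat_mul]; congr 1; push_cast; ring
    have hpow' : ∀ i : ℕ, Complex.exp (Complex.I * θ * ((-((i + 1 : ℕ) : ℝ) : ℝ) : ℂ)) =
        w⁻¹ ^ (i + 1) := fun i => by
      rw [inv_pow, ← hpow, ← Complex.exp_neg]; congr 1; push_cast; ring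
    have h1 : signedIntegral b (fun x => Complex.exp (Complex.I * θ * x) - 1) =
        (M.map fun ζ => -Complex.log (1 - ζ * 1)).sum -
          (M.map fun ζ => -Complex.log (1 - ζ * w⁻¹)).sum := by
      refine (hbf _ 2 hsm hbd).unique ?_
      have h := (hasSum_log_multiset hM norm_one).sub (hasSum_log_multiset hM hw2)
      have e : ∀ i : ℕ, (coef M i : ℂ) *
          (Complex.exp (Complex.I * θ * ((-((i + 1 : ℕ) : ℝ) : ℝ) : ℂ)) - 1) =
          ((i + 1 : ℕ) : ℂ)⁻¹ * (M.map fun ζ => ζ ^ (i + 1)).sum * 1 ^ (i + 1) -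
            ((i + 1 : ℕ) : ℂ)⁻¹ * (M.map fun ζ => ζ ^ (i + 1)).sum * w⁻¹ ^ (i + 1) := fun i => by
        rw [hcM, hpow', one_pow]
        ring
      simp only [e]
      exact h
    have h2 : signedIntegral c (fun x => Complex.exp (Complex.I * θ * x) - 1) =
        (N.map fun ζ => -Complex.log (1 - ζ * 1)).sum -
          (N.map fun ζ => -Complex.log (1 - ζ * w)).sum := by
      refine (hcf _ 2 hsm hbd).unique ?_
      have h := (hasSum_log_multiset hN norm_one).sub (hasSum_log_multiset hN hw1)
      have e : ∀ i : ℕ, (coef N i : ℂ) *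
          (Complex.exp (Complex.I * θ * (((i + 1 : ℕ) : ℝ) : ℂ)) - 1) =
          ((i + 1 : ℕ) : ℂ)⁻¹ * (N.map fun ζ => ζ ^ (i + 1)).sum * 1 ^ (i + 1) -
            ((i + 1 : ℕ) : ℂ)⁻¹ * (N.map fun ζ => ζ ^ (i + 1)).sum * w ^ (i + 1) := fun i => by
        rw [hcN, hpow, one_pow]
        ring
      simp only [e]
      exact h
    rw [signedIntegral_add _ _ hsm hbd, h1, h2, Complex.exp_add, Complex.exp_add,
      Complex.exp_sub, Complex.exp_sub, exp_log_multiset hM norm_one, exp_log_multiset hM hw2,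
      exp_log_multiset hN norm_one, exp_log_multiset hN hw1, hp.aeval_eq_prod hw1, ← hMdef,
      ← hNdef]
    have h3 : Complex.exp (Complex.I * θ * ((M.card : ℝ) : ℂ)) = w ^ M.card := by
      rw [hw, ← Complex.exp_nat_mul]; congr 1; push_cast; ring
    rw [h3]
    simp only [div_eq_mul_inv, inv_inv]
    ring

/-- On the unit circle a weight polynomial is the exponential of an integral against its root
measure. -/
theorem IsRootMeasure.aeval_exp_eq {p : ℝ[X]} (hp : IsWeightPolynomial p) {b : SignedMeasure ℝ}
    (hb : IsRootMeasure p b) (θ : ℝ) :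
    aeval (Complex.exp (Complex.I * θ)) p =
      Complex.exp (Complex.I * θ * ((innerRoots p).card : ℝ) +
        signedIntegral b fun x => Complex.exp (Complex.I * θ * x) - 1) := by
  obtain ⟨c, hc, h⟩ := hp.exists_rootMeasure
  rw [hb.unique hc]
  exact h θ

/-! ### Atomless point processes with a finite Lévy measure -/

theorem charFun_map_eq_integral {Ω : Type*} [MeasurableSpace Ω] {P : Measure Ω} {X : Ω → ℝ}
    (hX : AEMeasurable X P) (θ : ℝ) :
    charFun (P.map X) θ = ∫ ω, Complex.exp (Complex.I * θ * X ω) ∂P := by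
  rw [charFun_apply_real, integral_map hX (by fun_prop)]
  refine integral_congr_ae (.of_forall fun ω => ?_)
  ring_nf

theorem natCast_eq_zero_of_exp_eq_one {m : ℕ} (h : Complex.exp (Complex.I * (m : ℂ)) = 1) :
    m = 0 := by
  obtain ⟨k, hk⟩ := Complex.exp_eq_one_iff.mp h
  have h1 : (m : ℂ) = k * (2 * Real.pi) := by
    have : Complex.I * (m : ℂ) = Complex.I * (k * (2 * Real.pi)) := by rw [hk]; ring
    exact mul_left_cancel₀ Complex.I_ne_zero this
  have h2 : (m : ℝ) = k * (2 * Real.pi) := by exact_mod_cast h1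
  by_contra hm
  have hk0 : (k : ℝ) ≠ 0 := fun h0 => by
    rw [h0, zero_mul] at h2
    exact hm (by exact_mod_cast h2)
  refine irrational_pi ⟨(m : ℚ) / (2 * k), ?_⟩
  push_cast
  rw [h2]
  field_simp

section Levy

variable {S : Type u}

theorem integrable_exp_I_mul_snd_sub_one [MeasurableSpace S] (μ : Measure (S × ℝ))
    [IsFiniteMeasure μ] (θ : ℝ) :
    Integrable (fun z : S × ℝ => Complex.exp (Complex.I * θ * z.2) - 1) μ :=
  Integrable.of_bound ((stronglyMeasurable_exp_I_mul_sub_one θ).comp_measurable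
    measurable_snd).aestronglyMeasurable 2 (.of_forall fun z => norm_exp_I_mul_sub_one_le θ z.2)

theorem ae_exp_eq_one_of_re_integral_eq_zero [MeasurableSpace S] {μ : Measure (S × ℝ)}
    [IsFiniteMeasure μ] {θ : ℝ}
    (h : (∫ z, (Complex.exp (Complex.I * θ * z.2) - 1) ∂μ).re = 0) :
    ∀ᵐ z ∂μ, Complex.exp (Complex.I * θ * z.2) = 1 := by
  have hint := integrable_exp_I_mul_snd_sub_one μ θ
  have h1 : ∫ z, -(Complex.exp (Complex.I * θ * z.2) - 1).re ∂μ = 0 := by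
    rw [integral_neg, neg_eq_zero]
    exact (integral_re hint).trans h
  have hre : ∀ z : S × ℝ, (Complex.exp (Complex.I * θ * z.2)).re ≤ 1 := fun z =>
    (Complex.re_le_norm _).trans (norm_exp_I_mul θ z.2).le
  have hnonneg : 0 ≤ fun z : S × ℝ => -(Complex.exp (Complex.I * θ * z.2) - 1).re :=
    fun z => by simpa using hre z
  have hint' : Integrable (fun z : S × ℝ => -(Complex.exp (Complex.I * θ * z.2) - 1).re) μ :=
    hint.re.neg
  rw [integral_eq_zero_iff_of_nonneg hnonneg hint'] at h1
  filter_upwards [h1] with z hz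
  have h2 : (Complex.exp (Complex.I * θ * z.2)).re = 1 := by
    simp only [Complex.sub_re, Complex.one_re, Pi.zero_apply] at hz
    linarith
  have h3 := norm_exp_I_mul θ z.2
  have h4 : Complex.normSq (Complex.exp (Complex.I * θ * z.2)) = 1 := by
    rw [Complex.normSq_eq_norm_sq, h3, one_pow]
  rw [Complex.normSq_apply, h2] at h4
  refine Complex.ext h2 ?_
  rw [Complex.one_im]
  nlinarith

theorem re_eq_zero_of_exp_eq_one {z : ℂ} (h : Complex.exp z = 1) : z.re = 0 := by
  have := congrArg norm h
  rw [Complex.norm_exp, norm_one] at this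
  exact Real.exp_eq_one_iff _ |>.mp this

theorem exists_bounded_exhaustion (S : Type u) [MetricSpace S] [MeasurableSpace S]
    [OpensMeasurableSpace S] :
    ∃ K : ℕ → Set S, Monotone K ∧ (∀ n, MeasurableSet (K n)) ∧
      (∀ n, Bornology.IsBounded (K n)) ∧ ⋃ n, K n = Set.univ := by
  rcases isEmpty_or_nonempty S with hS | ⟨⟨x⟩⟩
  · exact ⟨fun _ => ∅, fun _ _ _ => le_rfl, fun _ => MeasurableSet.empty,
      fun _ => Bornology.isBounded_empty, Set.eq_univ_of_forall fun x => hS.elim x⟩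
  · exact ⟨fun n => Metric.closedBall x n, fun m n h =>
      Metric.closedBall_subset_closedBall (by exact_mod_cast h),
      fun n => measurableSet_closedBall, fun n => Metric.isBounded_closedBall,
      Metric.iUnion_closedBall_nat x⟩

variable [MetricSpace S] [MeasurableSpace S] {Ω : Type v} [MeasurableSpace Ω] {P : Measure Ω}
  [IsProbabilityMeasure P] {α : Ω → Measure S} {γ : Measure S} {F : Measure (S × ℝ)}

theorem IsRandomMeasure.measurable_toReal (hα : IsRandomMeasure α) {A : Set S}
    (hA : MeasurableSet A) : Measurable fun ω => (α ω A).toReal :=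
  ((Measure.measurable_coe hA).comp hα.measurable).ennreal_toReal

/-- The jumps of a point process are integers, and so is its drift: the characteristic function
of an integer-valued random variable is equal to `1` at `2π`. -/
theorem IsLevyPair.integer_of_integerValued (hα : IsPointProcess α)
    (h : IsLevyPair P α γ F) [IsFiniteMeasure F] {A : Set S} (hA : MeasurableSet A)
    (hb : Bornology.IsBounded A) :
    (∀ᵐ z ∂F.restrict (A ×ˢ Set.univ), ∃ m : ℕ, 1 ≤ m ∧ z.2 = (m : ℝ)) ∧ ∃ m : ℕ, γ A = m := by
  have h1 : charFun (P.map fun ω => (α ω A).toReal) (2 * Real.pi) = 1 := by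
    rw [charFun_map_eq_integral (hα.measurable_toReal hA).aemeasurable]
    have : ∀ ω, Complex.exp (Complex.I * ((2 * Real.pi : ℝ) : ℂ) * ((α ω A).toReal : ℂ)) = 1 :=
      fun ω => by
        obtain ⟨m, hm⟩ := hα.integerValued ω A hA hb
        rw [hm, ENNReal.toReal_natCast, Complex.exp_eq_one_iff]
        exact ⟨m, by push_cast; ring⟩
    simp only [this]
    simp
  rw [h.charFun_eq A hA hb] at h1
  have h2 := re_eq_zero_of_exp_eq_one h1
  have h3 : (Complex.I * ((2 * Real.pi : ℝ) : ℂ) * (((γ A).toReal : ℝ) : ℂ)).re = 0 := by simp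
  rw [Complex.add_re, h3, zero_add] at h2
  have h4 := ae_exp_eq_one_of_re_integral_eq_zero h2
  have h5 : ∫ z in A ×ˢ (Set.univ : Set ℝ),
      (Complex.exp (Complex.I * ((2 * Real.pi : ℝ) : ℂ) * z.2) - 1) ∂F = 0 := by
    rw [integral_eq_zero_of_ae]
    filter_upwards [h4] with z hz
    rw [hz, sub_self, Pi.zero_apply]
  rw [h5, add_zero] at h1
  have key : ∀ x : ℝ, 0 ≤ x → Complex.exp (Complex.I * ((2 * Real.pi : ℝ) : ℂ) * (x : ℂ)) = 1 →
      ∃ m : ℕ, x = m := fun x hx hx1 => by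
    obtain ⟨k, hk⟩ := Complex.exp_eq_one_iff.mp hx1
    have h6 : (2 * Real.pi * Complex.I) * (x : ℂ) = (2 * Real.pi * Complex.I) * k := by
      rw [mul_comm _ (k : ℂ), ← hk]; push_cast; ring
    have h7 : x = k := by exact_mod_cast mul_left_cancel₀ Complex.two_pi_I_ne_zero h6
    have h8 : 0 ≤ k := by rw [h7] at hx; exact_mod_cast hx
    lift k to ℕ using h8
    exact ⟨k, by exact_mod_cast h7⟩
  constructor
  · filter_upwards [h4, ae_restrict_of_ae h.levy_positive] with z hz hz0
    obtain ⟨m, hm⟩ := key z.2 hz0.le hz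
    refine ⟨m, ?_, hm⟩
    rw [hm] at hz0
    exact_mod_cast hz0
  · obtain ⟨m, hm⟩ := key _ ENNReal.toReal_nonneg h1
    refine ⟨m, ?_⟩
    rw [← ENNReal.ofReal_toReal (h.drift_lt_top A hA hb).ne, hm, ENNReal.ofReal_natCast]

theorem IsLevyPair.ae_natural [OpensMeasurableSpace S] (hα : IsPointProcess α)
    (h : IsLevyPair P α γ F) [IsFiniteMeasure F] :
    ∀ᵐ z ∂F, ∃ m : ℕ, 1 ≤ m ∧ z.2 = (m : ℝ) := by
  obtain ⟨K, -, hKm, hKb, hKu⟩ := exists_bounded_exhaustion S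
  have h1 : ∀ᵐ z ∂F.restrict (⋃ n, K n ×ˢ (Set.univ : Set ℝ)), ∃ m : ℕ, 1 ≤ m ∧ z.2 = (m : ℝ) := by
    rw [ae_restrict_iUnion_iff]
    exact fun n => (h.integer_of_integerValued hα (hKm n) (hKb n)).1
  rwa [← Set.iUnion_prod_const, hKu, Set.univ_prod_univ, Measure.restrict_univ] at h1

theorem IsLevyPair.singleton_eq_zero [BorelSpace S] (hα : IsPointProcess α)
    (ha : IsAtomless P α) (h : IsLevyPair P α γ F) [IsFiniteMeasure F] (x : S) :
    F ({x} ×ˢ Set.univ) = 0 ∧ γ {x} = 0 := by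
  have hm : MeasurableSet ({x} : Set S) := measurableSet_singleton x
  have hb : Bornology.IsBounded ({x} : Set S) := Bornology.isBounded_singleton
  have h1 : charFun (P.map fun ω => (α ω {x}).toReal) 1 = 1 := by
    rw [charFun_map_eq_integral (hα.measurable_toReal hm).aemeasurable]
    have : ∫ ω, Complex.exp (Complex.I * ((1 : ℝ) : ℂ) * ((α ω {x}).toReal : ℂ)) ∂P =
        ∫ ω, (1 : ℂ) ∂P := by
      refine integral_congr_ae ?_
      filter_upwards [ha x] with ω hω
      simp [hω]
    rw [this]
    simp
  rw [h.charFun_eq _ hm hb] at h1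
  have h2 := re_eq_zero_of_exp_eq_one h1
  have h3 : (Complex.I * ((1 : ℝ) : ℂ) * (((γ {x}).toReal : ℝ) : ℂ)).re = 0 := by simp
  rw [Complex.add_re, h3, zero_add] at h2
  have h4 := ae_exp_eq_one_of_re_integral_eq_zero h2
  obtain ⟨h5, k, hk⟩ := h.integer_of_integerValued hα hm hb
  have h6 : F ({x} ×ˢ Set.univ) = 0 := by
    rw [← Measure.restrict_eq_zero, ← ae_eq_bot, ← Filter.eventually_false_iff_eq_bot]
    filter_upwards [h4, h5] with z hz ⟨m, hm1, hm2⟩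
    rw [hm2, Complex.ofReal_one, mul_one, Complex.ofReal_natCast] at hz
    have := natCast_eq_zero_of_exp_eq_one hz
    omega
  refine ⟨h6, ?_⟩
  rw [setIntegral_measure_zero _ h6, add_zero, hk, Complex.ofReal_one, mul_one,
    ENNReal.toReal_natCast, Complex.ofReal_natCast] at h1
  rw [hk, natCast_eq_zero_of_exp_eq_one h1, Nat.cast_zero]

/-- A diffuse measure with integer values on bounded sets vanishes, since every point has a
neighbourhood of measure less than `1`. -/
theorem IsLevyPair.drift_eq_zero [BorelSpace S] [SecondCountableTopology S]
    (hα : IsPointProcess α) (ha : IsAtomless P α) (h : IsLevyPair P α γ F) [IsFiniteMeasure F] :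
    γ = 0 := by
  rw [← Measure.measure_univ_eq_zero]
  refine measure_null_of_locally_null _ fun x _ => ?_
  rw [nhdsWithin_univ]
  have h0 := (h.singleton_eq_zero hα ha x).2
  have hlf : IsLocallyFiniteMeasure γ := ⟨fun y => ⟨Metric.ball y 1, Metric.ball_mem_nhds y one_pos,
    h.drift_lt_top _ measurableSet_ball Metric.isBounded_ball⟩⟩
  obtain ⟨U, hxU, hU, hU1⟩ := Set.exists_isOpen_lt_of_lt ({x} : Set S) (μ := γ) 1
    (by rw [h0]; exact one_pos)
  refine ⟨U ∩ Metric.ball x 1, Filter.inter_mem (hU.mem_nhds (hxU rfl))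
    (Metric.ball_mem_nhds x one_pos), ?_⟩
  obtain ⟨-, k, hk⟩ := h.integer_of_integerValued hα
    (hU.measurableSet.inter measurableSet_ball) (Metric.isBounded_ball.subset Set.inter_subset_right
      : Bornology.IsBounded (U ∩ Metric.ball x 1))
  have h1 : γ (U ∩ Metric.ball x 1) < 1 := (measure_mono Set.inter_subset_left).trans_lt hU1
  rw [hk] at h1 ⊢
  have : k < 1 := by exact_mod_cast h1
  simp [Nat.lt_one_iff.mp this]

end Levy

theorem norm_setIntegral_exp_sub_one_le {S : Type u} [MeasurableSpace S] (F : Measure (S × ℝ))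
    [IsFiniteMeasure F] (A : Set S) (θ : ℝ) :
    ‖∫ z in A ×ˢ (Set.univ : Set ℝ), (Complex.exp (Complex.I * θ * z.2) - 1) ∂F‖ ≤
      2 * F.real (A ×ˢ Set.univ) :=
  norm_setIntegral_le_of_norm_le_const (measure_lt_top _ _)
    fun z _ => norm_exp_I_mul_sub_one_le θ z.2

section FiniteLevy

variable {S : Type u} [MetricSpace S] [MeasurableSpace S] {Ω : Type v} [MeasurableSpace Ω]
  {P : Measure Ω} [IsProbabilityMeasure P] {α : Ω → Measure S} {F : Measure (S × ℝ)}

theorem norm_one_sub_charFun_le (hα : IsPointProcess α) (h : IsLevyPair P α 0 F)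
    [IsFiniteMeasure F] {A : Set S} (hA : MeasurableSet A) (hb : Bornology.IsBounded A) (θ : ℝ) :
    ‖1 - charFun (P.map fun ω => (α ω A).toReal) θ‖ ≤ 4 * F.real (A ×ˢ Set.univ) := by
  have hprob : IsProbabilityMeasure (P.map fun ω => (α ω A).toReal) :=
    Measure.isProbabilityMeasure_map (hα.measurable_toReal hA).aemeasurable
  have h1 := norm_setIntegral_exp_sub_one_le F A θ
  have h2 := h.charFun_eq A hA hb θ
  rw [Measure.coe_zero, Pi.zero_apply, ENNReal.toReal_zero, Complex.ofReal_zero, mul_zero,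
    zero_add] at h2
  set W := ∫ z in A ×ˢ (Set.univ : Set ℝ), (Complex.exp (Complex.I * θ * z.2) - 1) ∂F
  rcases le_total ‖W‖ 1 with hW | hW
  · have h3 := Complex.norm_exp_sub_one_le hW
    rw [h2, norm_sub_rev]
    linarith
  · have h3 : ‖charFun (P.map fun ω => (α ω A).toReal) θ‖ ≤ 1 := norm_charFun_le_one _
    have h4 := norm_sub_le 1 (charFun (P.map fun ω => (α ω A).toReal) θ)
    rw [norm_one] at h4
    linarith

/-- The tail bound for characteristic functions at level `1 / 2`, which separates `0` from the
positive integers. -/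
theorem measureReal_ne_zero_le (hα : IsPointProcess α) (h : IsLevyPair P α 0 F)
    [IsFiniteMeasure F] {A : Set S} (hA : MeasurableSet A) (hb : Bornology.IsBounded A) :
    P.real {ω | α ω A ≠ 0} ≤ 8 * F.real (A ×ˢ Set.univ) := by
  have hX := hα.measurable_toReal hA
  have hprob : IsProbabilityMeasure (P.map fun ω => (α ω A).toReal) :=
    Measure.isProbabilityMeasure_map hX.aemeasurable
  have h1 := measureReal_abs_gt_le_integral_charFun (μ := P.map fun ω => (α ω A).toReal)
    (r := 1 / 2) (by norm_num)
  have h2 := intervalIntegral.norm_integral_le_of_norm_le_const (a := -2 * (1 / 2 : ℝ)⁻¹)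
    (b := 2 * (1 / 2 : ℝ)⁻¹) fun θ _ => norm_one_sub_charFun_le hα h hA hb θ
  have h3 : {ω | α ω A ≠ 0} ⊆ (fun ω => (α ω A).toReal) ⁻¹' {x | 1 / 2 < |x|} := fun ω hω => by
    obtain ⟨m, hm⟩ := hα.integerValued ω A hA hb
    have hm0 : m ≠ 0 := fun h0 => hω (by rw [hm, h0, Nat.cast_zero])
    have hm1 : (1 : ℝ) ≤ m := by exact_mod_cast Nat.one_le_iff_ne_zero.mpr hm0
    simp only [Set.mem_preimage, Set.mem_ofPred_eq, hm, ENNReal.toReal_natCast, Nat.abs_cast]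
    linarith
  have hms : MeasurableSet {x : ℝ | 1 / 2 < |x|} := measurableSet_lt measurable_const (by fun_prop)
  calc P.real {ω | α ω A ≠ 0} ≤ P.real ((fun ω => (α ω A).toReal) ⁻¹' {x | 1 / 2 < |x|}) :=
        measureReal_mono h3
    _ = (P.map fun ω => (α ω A).toReal).real {x | 1 / 2 < |x|} :=
        (map_measureReal_apply hX hms).symm
    _ ≤ _ := h1
    _ ≤ 2⁻¹ * (1 / 2) * (4 * F.real (A ×ˢ Set.univ) *
          |2 * (1 / 2 : ℝ)⁻¹ - -2 * (1 / 2 : ℝ)⁻¹|) := by gcongr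
    _ = 8 * F.real (A ×ˢ Set.univ) := by norm_num; ring

/-- A point process with a finite Lévy measure has finitely many points: it charges the `k`-th
annulus of a bounded exhaustion with a probability that is summable in `k`. -/
theorem IsLevyPair.ae_univ_lt_top [OpensMeasurableSpace S] (hα : IsPointProcess α)
    (h : IsLevyPair P α 0 F) [IsFiniteMeasure F] : ∀ᵐ ω ∂P, α ω Set.univ < ∞ := by
  obtain ⟨K, -, hKm, hKb, hKu⟩ := exists_bounded_exhaustion S
  have hDm : ∀ n, MeasurableSet (disjointed K n) := fun n => MeasurableSet.disjointed hKm n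
  have hDb : ∀ n, Bornology.IsBounded (disjointed K n) := fun n =>
    (hKb n).subset (disjointed_subset K n)
  have hDu : ⋃ n, disjointed K n = Set.univ := (iUnion_disjointed).trans hKu
  have hsum : ∑' n, P {ω | α ω (disjointed K n) ≠ 0} ≠ ∞ := by
    have h1 : ∀ n, P {ω | α ω (disjointed K n) ≠ 0} ≤
        8 * F (disjointed K n ×ˢ Set.univ) := fun n => by
      have := measureReal_ne_zero_le hα h (hDm n) (hDb n)
      rw [← ENNReal.toReal_le_toReal (measure_ne_top _ _)
        (ENNReal.mul_ne_top (by simp) (measure_ne_top _ _)), ENNReal.toReal_mul]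
      simpa [measureReal_def] using this
    refine ne_top_of_le_ne_top ?_ (ENNReal.tsum_le_tsum h1)
    rw [ENNReal.tsum_mul_left, ← measure_iUnion]
    · exact ENNReal.mul_ne_top (by simp) (measure_ne_top _ _)
    · intro i j hij
      exact Set.disjoint_prod.mpr (Or.inl (disjoint_disjointed K hij))
    · exact fun n => (hDm n).prod MeasurableSet.univ
  filter_upwards [ae_eventually_notMem hsum] with ω hω
  obtain ⟨N, hN⟩ := Filter.eventually_atTop.mp hω
  rw [← hDu, measure_iUnion (disjoint_disjointed K) hDm,
    tsum_eq_sum (s := Finset.range N) fun n hn => ?_]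
  · exact ENNReal.sum_lt_top.mpr fun n _ => hα.locallyFinite ω _ (hDm n) (hDb n)
  · simpa using hN n (by simpa using hn)

theorem IsLevyPair.charFun_eq_of_finite [OpensMeasurableSpace S] (hα : IsPointProcess α)
    (h : IsLevyPair P α 0 F) [IsFiniteMeasure F] {A : Set S} (hA : MeasurableSet A) (θ : ℝ) :
    charFun (P.map fun ω => (α ω A).toReal) θ =
      Complex.exp (∫ z in A ×ˢ (Set.univ : Set ℝ), (Complex.exp (Complex.I * θ * z.2) - 1) ∂F) := by
  obtain ⟨K, hKmono, hKm, hKb, hKu⟩ := exists_bounded_exhaustion S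
  have hEm : ∀ n, MeasurableSet (A ∩ K n) := fun n => hA.inter (hKm n)
  have hEb : ∀ n, Bornology.IsBounded (A ∩ K n) := fun n => (hKb n).subset Set.inter_subset_right
  have hEmono : Monotone fun n => A ∩ K n := fun m n hmn =>
    Set.inter_subset_inter_right A (hKmono hmn)
  have hEu : ⋃ n, A ∩ K n = A := by rw [← Set.inter_iUnion, hKu, Set.inter_univ]
  have h1 : Filter.Tendsto (fun n => charFun (P.map fun ω => (α ω (A ∩ K n)).toReal) θ)
      Filter.atTop (nhds (charFun (P.map fun ω => (α ω A).toReal) θ)) := by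
    simp only [charFun_map_eq_integral (hα.measurable_toReal (hEm _)).aemeasurable,
      charFun_map_eq_integral (hα.measurable_toReal hA).aemeasurable]
    refine tendsto_integral_of_dominated_convergence (fun _ => 1) (fun n => ?_)
      (integrable_const _) (fun n => .of_forall fun ω => (norm_exp_I_mul _ _).le) ?_
    · have := hα.measurable_toReal (hEm n)
      exact (by fun_prop : Measurable fun ω => Complex.exp (Complex.I * θ *
        ((α ω (A ∩ K n)).toReal : ℝ))).aestronglyMeasurable
    · filter_upwards [h.ae_univ_lt_top hα] with ω hω
      have hlt : α ω A ≠ ∞ := ((measure_mono (Set.subset_univ A)).trans_lt hω).ne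
      have h2 : Filter.Tendsto (fun n => α ω (A ∩ K n)) Filter.atTop (nhds (α ω A)) := by
        have := tendsto_measure_iUnion_atTop (μ := α ω) hEmono
        rwa [hEu] at this
      have h3 := (ENNReal.tendsto_toReal hlt).comp h2
      have h4 : Continuous fun x : ℝ => Complex.exp (Complex.I * θ * x) := by fun_prop
      exact (h4.tendsto _).comp h3
  have h2 : Filter.Tendsto (fun n => ∫ z in (A ∩ K n) ×ˢ (Set.univ : Set ℝ),
        (Complex.exp (Complex.I * θ * z.2) - 1) ∂F) Filter.atTop
      (nhds (∫ z in A ×ˢ (Set.univ : Set ℝ), (Complex.exp (Complex.I * θ * z.2) - 1) ∂F)) := by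
    have := tendsto_setIntegral_of_monotone (μ := F)
      (s := fun n => (A ∩ K n) ×ˢ (Set.univ : Set ℝ))
      (f := fun z : S × ℝ => Complex.exp (Complex.I * θ * z.2) - 1)
      (fun n => (hEm n).prod MeasurableSet.univ)
      (fun m n hmn => Set.prod_mono (hEmono hmn) le_rfl)
      (integrable_exp_I_mul_snd_sub_one F θ).integrableOn
    rwa [← Set.iUnion_prod_const, hEu] at this
  refine tendsto_nhds_unique h1 (Filter.Tendsto.congr (fun n => ?_)
    ((Complex.continuous_exp.tendsto _).comp h2))
  rw [Function.comp_apply, h.charFun_eq _ (hEm n) (hEb n)]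
  simp

end FiniteLevy

/-! ### The fixed atoms and their generating polynomials -/

/-- The generating polynomial of a quasi-infinitely divisible random variable with finitely many
values in the nonnegative integers. It has no root on the unit circle, since there it is given by
the characteristic function, which is an exponential. -/
theorem exists_weightPolynomial {Ω : Type v} [MeasurableSpace Ω] {P : Measure Ω}
    [IsProbabilityMeasure P] {β : Ω → ℝ} (hβ : Measurable β) (hq : IsQID (P.map β))
    (hT : ∃ T : Finset ℕ, ∀ᵐ ω ∂P, ∃ l ∈ T, β ω = l) (hpos : 0 < P {ω | 0 < β ω}) :
    ∃ p : ℝ[X], (∀ l, p.coeff l = P.real {ω | β ω = (l : ℝ)}) ∧ IsWeightPolynomial p ∧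
      ∀ θ : ℝ, charFun (P.map β) θ = aeval (Complex.exp (Complex.I * θ)) p := by
  obtain ⟨T, hT⟩ := hT
  have hm : ∀ l : ℕ, MeasurableSet {ω | β ω = (l : ℝ)} := fun l =>
    measurableSet_eq_fun hβ measurable_const
  set p : ℝ[X] := ∑ l ∈ T, C (P.real {ω | β ω = (l : ℝ)}) * X ^ l with hp
  have hcoeff : ∀ l, p.coeff l = P.real {ω | β ω = (l : ℝ)} := fun l => by
    rw [hp, finsetSum_coeff]
    simp only [coeff_C_mul, coeff_X_pow, mul_ite, mul_one, mul_zero, Finset.sum_ite_eq]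
    split_ifs with hl
    · rfl
    · symm
      rw [measureReal_def, ENNReal.toReal_eq_zero_iff]
      left
      have : ∀ᵐ ω ∂P, ¬ β ω = (l : ℝ) := by
        filter_upwards [hT] with ω ⟨k, hk, hk'⟩ h
        rw [hk'] at h
        exact hl ((by exact_mod_cast h : k = l) ▸ hk)
      simpa [ae_iff] using this
  have hchar : ∀ θ : ℝ, charFun (P.map β) θ = aeval (Complex.exp (Complex.I * θ)) p := fun θ => by
    rw [charFun_map_eq_integral hβ.aemeasurable]
    have h1 : (fun ω => Complex.exp (Complex.I * θ * β ω)) =ᵐ[P] fun ω =>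
        ∑ l ∈ T, Set.indicator {ω | β ω = (l : ℝ)}
          (fun _ => Complex.exp (Complex.I * θ * (l : ℝ))) ω := by
      filter_upwards [hT] with ω ⟨k, hk, hk'⟩
      rw [Finset.sum_eq_single_of_mem k hk]
      · rw [Set.indicator_of_mem (by exact hk'), hk']
      · intro l _ hlk
        refine Set.indicator_of_notMem (fun h => hlk ?_) _
        have h' : β ω = (l : ℝ) := h
        rw [hk'] at h'
        exact_mod_cast h'.symm
    rw [integral_congr_ae h1, integral_finsetSum _ fun l _ =>
      (integrable_const _).indicator (hm l), hp, map_sum]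
    refine Finset.sum_congr rfl fun l _ => ?_
    rw [integral_indicator_const _ (hm l), map_mul, map_pow, aeval_C, aeval_X, ← Complex.exp_nat_mul,
      Complex.real_smul]
    simp only [Complex.coe_algebraMap, Complex.ofReal_natCast]
    rw [mul_comm (Complex.I * (θ : ℂ)) (l : ℂ)]
  refine ⟨p, hcoeff, ⟨fun l => ?_, ?_, ?_, ?_⟩, hchar⟩
  · rw [hcoeff]
    exact measureReal_nonneg
  · have hprob : IsProbabilityMeasure (P.map β) := Measure.isProbabilityMeasure_map hβ.aemeasurable
    have h := hchar 0
    rw [charFun_zero, probReal_univ, Complex.ofReal_zero, mul_zero, Complex.exp_zero,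
      ← map_one (algebraMap ℝ ℂ), aeval_algebraMap_apply, aeval_def, Algebra.algebraMap_self,
      eval₂_id] at h
    simp only [Complex.coe_algebraMap, Complex.ofReal_one] at h
    exact_mod_cast h.symm
  · by_contra hdeg
    have h0 : ∀ l : ℕ, 1 ≤ l → ∀ᵐ ω ∂P, ¬ β ω = (l : ℝ) := fun l hl => by
      have h1 : P.real {ω | β ω = (l : ℝ)} = 0 := by
        rw [← hcoeff]
        exact coeff_eq_zero_of_natDegree_lt (by omega)
      rw [measureReal_eq_zero_iff] at h1
      simpa [ae_iff] using h1
    have h2 : ∀ᵐ ω ∂P, ¬ 0 < β ω := by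
      filter_upwards [hT, ae_all_iff.mpr fun l => ae_all_iff.mpr (h0 l)] with ω ⟨k, _, hk'⟩ hω hlt
      have : 1 ≤ k := by
        rw [hk'] at hlt
        exact_mod_cast hlt
      exact hω k this hk'
    rw [ae_iff] at h2
    simp only [not_not] at h2
    exact hpos.ne' h2
  · intro w hw h0
    obtain ⟨θ, hθ⟩ := (Complex.norm_eq_one_iff w).mp hw
    obtain ⟨d, g, ν, hν⟩ := hq
    have h := hchar θ
    rw [mul_comm, hθ, h0, hν] at h
    exact Complex.exp_ne_zero _ h

section Superposition

variable {S : Type u} [MeasurableSpace S] {Ω : Type v} [MeasurableSpace Ω] {P : Measure Ω} {n : ℕ}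

open Classical in
theorem toReal_add_sum_dirac_apply {μ : Measure S} {A : Set S} (hA : MeasurableSet A)
    (hμ : μ A < ∞) {s : Fin n → S} {x : Fin n → ℝ} (hx : ∀ j, 0 ≤ x j) :
    ((μ + ∑ j, ENNReal.ofReal (x j) • Measure.dirac (s j)) A).toReal =
      (μ A).toReal + ∑ j, (if s j ∈ A then 1 else 0) * x j := by
  rw [Measure.add_apply, Measure.finsetSum_apply, ENNReal.toReal_add hμ.ne,
    ENNReal.toReal_sum]
  · congr 1
    refine Finset.sum_congr rfl fun j _ => ?_
    by_cases hj : s j ∈ A <;> simp [Measure.dirac_apply' _ hA, hj, hx j]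
  · intro j _
    by_cases hj : s j ∈ A <;> simp [Measure.dirac_apply' _ hA, hj]
  · refine (ENNReal.sum_lt_top.mpr fun j _ => ?_).ne
    by_cases hj : s j ∈ A <;> simp [Measure.dirac_apply' _ hA, hj]

theorem charFun_sum_mul {β : Fin n → Ω → ℝ} (hβ : ∀ j, Measurable (β j)) (hi : iIndepFun β P)
    (c : Fin n → ℝ) (θ : ℝ) :
    charFun (P.map fun ω => ∑ j, c j * β j ω) θ = ∏ j, charFun (P.map (β j)) (c j * θ) := by
  have h1 : iIndepFun (fun j ω => c j * β j ω) P :=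
    hi.comp (fun j x => c j * x) fun j => measurable_const_mul (c j)
  rw [h1.charFun_map_fun_sum_eq_prod fun j => ((hβ j).const_mul (c j)).aemeasurable,
    Finset.prod_apply]
  exact Finset.prod_congr rfl fun j _ => charFun_map_mul_comp (hβ j).aemeasurable _ _

theorem charFun_add_sum_mul {E : Type*} [MeasurableSpace E] [IsProbabilityMeasure P] {α : Ω → E}
    (hα : Measurable α) {φ : E → ℝ} (hφ : Measurable φ) {β : Fin n → Ω → ℝ}
    (hβ : ∀ j, Measurable (β j)) (hi : iIndepFun β P) (hαβ : IndepFun α (fun ω j => β j ω) P)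
    (c : Fin n → ℝ) (θ : ℝ) :
    charFun (P.map fun ω => φ (α ω) + ∑ j, c j * β j ω) θ =
      charFun (P.map fun ω => φ (α ω)) θ * ∏ j, charFun (P.map (β j)) (c j * θ) := by
  have h : IndepFun (fun ω => φ (α ω)) (fun ω => ∑ j, c j * β j ω) P :=
    hαβ.comp (ψ := fun x : Fin n → ℝ => ∑ j, c j * x j) hφ (by fun_prop)
  have hm : Measurable fun ω => φ (α ω) := hφ.comp hα
  rw [h.charFun_map_fun_add_eq_mul hm.aemeasurable (by fun_prop), Pi.mul_apply,
    charFun_sum_mul hβ hi]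

/-- The Lévy-Khintchine formula of a superposition of an atomless part and independent fixed
atoms. -/
theorem hasLevyKhintchine_of_eq_ae [MetricSpace S] [IsProbabilityMeasure P]
    {ξ α : Ω → Measure S} {s : Fin n → S} {β : Fin n → Ω → ℝ}
    {G : Measure (S × ℝ)} [IsFiniteMeasure G] {b : Fin n → SignedMeasure ℝ} {p : Fin n → ℝ[X]}
    {ν₀ : SignedMeasure S} {F : SignedMeasure (S × ℝ)}
    (hα : IsRandomMeasure α) (hfin : ∀ᵐ ω ∂P, α ω Set.univ < ∞)
    (hαc : ∀ A : Set S, MeasurableSet A → ∀ θ : ℝ, charFun (P.map fun ω => (α ω A).toReal) θ =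
      Complex.exp (∫ z in A ×ˢ (Set.univ : Set ℝ), (Complex.exp (Complex.I * θ * z.2) - 1) ∂G))
    (hβ : ∀ j, Measurable (β j)) (hβ0 : ∀ j, ∀ᵐ ω ∂P, 0 ≤ β j ω) (hβi : iIndepFun β P)
    (hαβ : IndepFun α (fun ω j => β j ω) P)
    (hξ : ∀ᵐ ω ∂P, ξ ω = α ω + ∑ j, ENNReal.ofReal (β j ω) • Measure.dirac (s j))
    (hβc : ∀ j, ∀ θ : ℝ, charFun (P.map (β j)) θ = aeval (Complex.exp (Complex.I * θ)) (p j))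
    (hp : ∀ j, IsWeightPolynomial (p j)) (hb : ∀ j, IsRootMeasure (p j) (b j))
    (hν : ∀ A : Set S, MeasurableSet A →
      ν₀ A = ∑ j, diracValue (s j) A * ((innerRoots (p j)).card : ℝ))
    (hF : ∀ (A : Set S) (B : Set ℝ), MeasurableSet A → MeasurableSet B →
      F (A ×ˢ B) = (G (A ×ˢ B)).toReal + ∑ j, diracValue (s j) A * b j B) :
    HasLevyKhintchine P ξ ν₀ F := by
  classical
  intro A hA
  have hfinA : ∀ᵐ ω ∂P, α ω A < ∞ := by
    filter_upwards [hfin] with ω hω using (measure_mono (Set.subset_univ A)).trans_lt hω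
  refine ⟨?_, fun θ => ?_⟩
  · filter_upwards [hξ, hfinA] with ω h1 h2
    rw [h1, Measure.add_apply, Measure.finsetSum_apply]
    refine ENNReal.add_lt_top.mpr ⟨h2, ENNReal.sum_lt_top.mpr fun j _ => ?_⟩
    by_cases hj : s j ∈ A <;> simp [Measure.dirac_apply' _ hA, hj]
  · have h1 : (fun ω => (ξ ω A).toReal) =ᵐ[P] fun ω =>
        (α ω A).toReal + ∑ j, (if s j ∈ A then 1 else 0) * β j ω := by
      filter_upwards [hξ, hfinA, ae_all_iff.mpr hβ0] with ω h1 h2 h3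
      rw [h1, toReal_add_sum_dirac_apply hA h2 h3]
    have hbf := norm_exp_I_mul_sub_one_le θ
    have hsm := stronglyMeasurable_exp_I_mul_sub_one θ
    rw [Measure.map_congr h1, charFun_add_sum_mul hα.measurable
      (φ := fun μ : Measure S => (μ A).toReal) (Measure.measurable_coe hA).ennreal_toReal hβ hβi
      hαβ,
      hαc A hA, signedIntegral_fiber hF hA hsm hbf, hν A hA]
    have h3 : ∀ j, charFun (P.map (β j)) ((if s j ∈ A then (1 : ℝ) else 0) * θ) =
        Complex.exp (
          Complex.I * θ * ((diracValue (s j) A * ((innerRoots (p j)).card : ℝ) : ℝ) : ℂ) +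
          if s j ∈ A then signedIntegral (b j) (fun x => Complex.exp (Complex.I * θ * x) - 1)
            else 0) := fun j => by
      by_cases hj : s j ∈ A
      · simp only [hj, if_true, one_mul, diracValue, Set.indicator_of_mem]
        rw [hβc, (hb j).aeval_exp_eq (hp j)]
      · have : IsProbabilityMeasure (P.map (β j)) :=
          Measure.isProbabilityMeasure_map (hβ j).aemeasurable
        simp [hj, diracValue]
    simp only [h3]
    rw [← Complex.exp_sum, ← Complex.exp_add, Finset.sum_add_distrib, Complex.ofReal_sum,
      Finset.mul_sum]
    congr 1
    ring

/-- The signed measures of an explicit pair exist for any choice of the data. -/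
theorem exists_signedMeasures (s : Fin n → S) (c : Fin n → ℝ) (G : Measure (S × ℝ))
    [IsFiniteMeasure G] (b : Fin n → SignedMeasure ℝ) :
    ∃ (ν₀ : SignedMeasure S) (F : SignedMeasure (S × ℝ)),
      (∀ A : Set S, MeasurableSet A → ν₀ A = ∑ j, diracValue (s j) A * c j) ∧
      ∀ (A : Set S) (B : Set ℝ), MeasurableSet A → MeasurableSet B →
        F (A ×ˢ B) = (G (A ×ˢ B)).toReal + ∑ j, diracValue (s j) A * b j B := by
  refine ⟨∑ j, c j • (Measure.dirac (s j)).toSignedMeasure,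
    G.toSignedMeasure + ∑ j, (b j).map fun x => (s j, x), fun A hA => ?_, fun A B hA hB => ?_⟩
  · rw [FunLike.coe_sum, Finset.sum_apply]
    refine Finset.sum_congr rfl fun j _ => ?_
    rw [_root_.smul_apply, Measure.toSignedMeasure_apply_measurable hA, measureReal_def,
      Measure.dirac_apply' _ hA, smul_eq_mul, mul_comm, diracValue]
    by_cases hj : s j ∈ A <;> simp [hj]
  · rw [_root_.add_apply, Measure.toSignedMeasure_apply_measurable (hA.prod hB), measureReal_def,
      FunLike.coe_sum, Finset.sum_apply]
    congr 1
    refine Finset.sum_congr rfl fun j _ => ?_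
    rw [VectorMeasure.map_apply _ (by fun_prop) (hA.prod hB), diracValue]
    by_cases hj : s j ∈ A <;> simp [hj]

end Superposition

section ExplicitPair

variable {S : Type u} [MetricSpace S] [MeasurableSpace S] [BorelSpace S]

theorem IsDecomposition.exists_explicitPair [SecondCountableTopology S] {Ω : Type v}
    [MeasurableSpace Ω] {P : Measure Ω} [IsProbabilityMeasure P] {ξ α : Ω → Measure S} {n : ℕ}
    {s : Fin n → S} {β : Fin n → Ω → ℝ} (hdec : IsDecomposition P ξ α s β) :
    ∃ p : Fin n → ℝ[X], (∀ j l, (p j).coeff l = P.real {ω | β j ω = (l : ℝ)}) ∧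
      ∃ (ν₀ : SignedMeasure S) (F : SignedMeasure (S × ℝ)),
        IsExplicitPair ν₀ F s p ∧ HasLevyKhintchine P ξ ν₀ F := by
  classical
  obtain ⟨γ, G, hG, hGfin⟩ := hdec.finiteLevy
  obtain rfl := hG.drift_eq_zero hdec.pointProcess hdec.atomless
  have hβ0 : ∀ j, ∀ᵐ ω ∂P, 0 ≤ β j ω := fun j => by
    obtain ⟨T, hT⟩ := hdec.finiteSupport j
    filter_upwards [hT] with ω ⟨l, _, hl⟩
    rw [hl]
    exact Nat.cast_nonneg l
  -- off a null set `ξ {s j} = β j`, because `α` has no fixed atoms and the `s j` are distinct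
  have hpos : ∀ j, 0 < P {ω | 0 < β j ω} := fun j => by
    refine (hdec.fixedAtom j).trans_le (measure_mono_ae ?_)
    filter_upwards [hdec.eq_ae, hdec.atomless (s j)] with ω h1 h2 h3
    have h4 : 0 < ξ ω {s j} := h3
    rw [h1, Measure.add_apply, h2, zero_add, Measure.finsetSum_apply,
      Finset.sum_eq_single_of_mem j (Finset.mem_univ j)] at h4
    · have h5 : 0 < β j ω := by simpa using h4
      exact h5
    · intro i _ hij
      have : s i ≠ s j := fun e => hij (hdec.injective e)
      simp [this]
  choose p hcoeff hp hchar using fun j =>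
    exists_weightPolynomial (hdec.measurable j) (hdec.qid j) (hdec.finiteSupport j) (hpos j)
  choose b hb _ using fun j => (hp j).exists_rootMeasure
  obtain ⟨ν₀, F, hν, hF⟩ := exists_signedMeasures s
    (fun j => ((innerRoots (p j)).card : ℝ)) G b
  refine ⟨p, hcoeff, ν₀, F, ⟨hdec.injective, hp, hν, G, b, hGfin,
    hG.ae_natural hdec.pointProcess, fun x B _ => ?_, hb, hF⟩, ?_⟩
  · exact measure_mono_null (Set.prod_mono le_rfl (Set.subset_univ B))
      (hG.singleton_eq_zero hdec.pointProcess hdec.atomless x).1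
  · exact hasLevyKhintchine_of_eq_ae hdec.pointProcess.toIsRandomMeasure
      (hG.ae_univ_lt_top hdec.pointProcess)
      (fun A hA θ => hG.charFun_eq_of_finite hdec.pointProcess hA θ) hdec.measurable hβ0 hdec.indep
      hdec.indep_atomless hdec.eq_ae hchar hp hb hν hF

end ExplicitPair

/-! ### Poisson processes with a finite intensity -/

section Poisson

variable {X : Type u} [MeasurableSpace X]

/-- The law of a Poisson process with finite intensity `G`, as a measure on finite sequences of
points: the sequences of length `N` carry `exp (-G X) / N!` times the `N`-fold product of `G`.
Leaving `G` unnormalized allows `G = 0`. -/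
noncomputable def poissonLaw (G : Measure X) : Measure (Σ N : ℕ, Fin N → X) :=
  Measure.sum fun N => ENNReal.ofReal (Real.exp (-G.real Set.univ) / (N.factorial : ℝ)) •
    (Measure.pi fun _ : Fin N => G).map (Sigma.mk (β := fun N => Fin N → X) N)

theorem measurable_sigma_mk (N : ℕ) :
    Measurable (Sigma.mk (β := fun N => Fin N → X) N) := fun _ hs =>
  MeasurableSpace.measurableSet_iInf.mp hs N

theorem measurable_of_measurable_comp_sigma_mk {Y : Type*} [MeasurableSpace Y]
    {f : (Σ N : ℕ, Fin N → X) → Y} (h : ∀ N, Measurable fun x : Fin N → X => f ⟨N, x⟩) :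
    Measurable f := fun _ hs => MeasurableSpace.measurableSet_iInf.mpr fun N => h N hs

instance isProbabilityMeasure_poissonLaw (G : Measure X) [IsFiniteMeasure G] :
    IsProbabilityMeasure (poissonLaw G) := by
  refine ⟨?_⟩
  rw [poissonLaw, Measure.sum_apply _ MeasurableSet.univ]
  have h : ∀ N : ℕ, (ENNReal.ofReal (Real.exp (-G.real Set.univ) / (N.factorial : ℝ)) •
      (Measure.pi fun _ : Fin N => G).map (Sigma.mk (β := fun N => Fin N → X) N)) Set.univ =
      ENNReal.ofReal (Real.exp (-G.real Set.univ) * G.real Set.univ ^ N / (N.factorial : ℝ)) :=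
    fun N => by
      rw [Measure.smul_apply, Measure.map_apply (measurable_sigma_mk N) MeasurableSet.univ,
        Set.preimage_univ, Measure.pi_univ, Finset.prod_const, Finset.card_univ, Fintype.card_fin,
        ← ofReal_measureReal, ← ENNReal.ofReal_pow measureReal_nonneg, smul_eq_mul,
        ← ENNReal.ofReal_mul (by positivity)]
      congr 1
      ring
  have hs : HasSum (fun N : ℕ => Real.exp (-G.real Set.univ) * G.real Set.univ ^ N /
      (N.factorial : ℝ)) 1 := hasSum_one_poissonMeasure ⟨G.real Set.univ, measureReal_nonneg⟩
  simp only [h]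
  rw [← ENNReal.ofReal_tsum_of_nonneg (fun N => by positivity) hs.summable, hs.tsum_eq,
    ENNReal.ofReal_one]

/-- The probability generating functional of a Poisson process. -/
theorem integral_prod_poissonLaw (G : Measure X) [IsFiniteMeasure G] {h : X → ℂ}
    (hm : Measurable h) (hb : ∀ x, ‖h x‖ ≤ 1) :
    ∫ ω, ∏ i, h (ω.2 i) ∂poissonLaw G = Complex.exp (∫ x, (h x - 1) ∂G) := by
  have hmeas : Measurable fun ω : Σ N : ℕ, Fin N → X => ∏ i, h (ω.2 i) :=
    measurable_of_measurable_comp_sigma_mk fun N =>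
      Finset.measurable_prod Finset.univ fun (i : Fin N) _ => hm.comp (measurable_pi_apply i)
  have hint : Integrable (fun ω : Σ N : ℕ, Fin N → X => ∏ i, h (ω.2 i)) (poissonLaw G) :=
    Integrable.of_bound hmeas.aestronglyMeasurable 1 (.of_forall fun ω => by
      rw [norm_prod]
      exact Finset.prod_le_one (fun i _ => norm_nonneg _) fun i _ => hb _)
  have hG : Integrable h G := Integrable.of_bound hm.aestronglyMeasurable 1 (.of_forall hb)
  have hterm : ∀ N : ℕ, ∫ ω, ∏ i, h (ω.2 i)
      ∂(ENNReal.ofReal (Real.exp (-G.real Set.univ) / (N.factorial : ℝ)) •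
        (Measure.pi fun _ : Fin N => G).map (Sigma.mk (β := fun N => Fin N → X) N)) =
      (Real.exp (-G.real Set.univ) : ℂ) * ((∫ x, h x ∂G) ^ N / (N.factorial : ℂ)) := fun N => by
    rw [integral_smul_measure, integral_map (measurable_sigma_mk N).aemeasurable
      hmeas.aestronglyMeasurable, integral_fintype_prod_eq_pow, Fintype.card_fin,
      ENNReal.toReal_ofReal (by positivity), Complex.real_smul]
    push_cast
    ring
  have h1 := hasSum_integral_measure hint
  simp only [hterm] at h1
  have h2 := (NormedSpace.expSeries_div_hasSum_exp (∫ x, h x ∂G)).mul_left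
    (Real.exp (-G.real Set.univ) : ℂ)
  rw [← Complex.exp_eq_exp_ℂ] at h2
  rw [integral_sub hG (integrable_const _), integral_const]
  refine (h1.unique h2).trans ?_
  rw [Complex.ofReal_exp, ← Complex.exp_add]
  congr 1
  simp
  ring

end Poisson

section ClusterProcess

variable {S : Type u} [MeasurableSpace S]

/-- The point process on `S` which puts mass `m` at `x` for each pair `(x, m)` of a finite
sequence. The marks are truncated to integers, which makes the process integer-valued for every
sequence. -/
noncomputable def clusterProcess (ω : Σ N : ℕ, Fin N → S × ℝ) : Measure S :=
  ∑ i, ((⌊(ω.2 i).2⌋₊ : ℕ) : ℝ≥0∞) • Measure.dirac (ω.2 i).1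

theorem clusterProcess_apply (ω : Σ N : ℕ, Fin N → S × ℝ) {A : Set S} (hA : MeasurableSet A) :
    clusterProcess ω A =
      ((∑ i, Set.indicator A (fun _ => ⌊(ω.2 i).2⌋₊) (ω.2 i).1 : ℕ) : ℝ≥0∞) := by
  rw [clusterProcess, Measure.finsetSum_apply, Nat.cast_sum]
  refine Finset.sum_congr rfl fun i _ => ?_
  by_cases hi : (ω.2 i).1 ∈ A <;> simp [Measure.dirac_apply' _ hA, hi]

theorem clusterProcess_lt_top (ω : Σ N : ℕ, Fin N → S × ℝ) (A : Set S) :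
    clusterProcess ω A < ∞ := by
  refine (measure_mono (Set.subset_univ A)).trans_lt ?_
  rw [clusterProcess_apply ω MeasurableSet.univ]
  exact ENNReal.natCast_lt_top _

theorem measurable_clusterProcess :
    Measurable (clusterProcess : (Σ N : ℕ, Fin N → S × ℝ) → Measure S) := by
  refine Measure.measurable_of_measurable_coe _ fun A hA => ?_
  simp only [clusterProcess_apply _ hA]
  refine measurable_of_measurable_comp_sigma_mk fun N => ?_
  have h : Measurable fun z : S × ℝ => Set.indicator A (fun _ => ⌊z.2⌋₊) z.1 :=
    Measurable.ite (measurable_fst hA) (Nat.measurable_floor.comp measurable_snd) measurable_const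
  exact (measurable_from_top (f := fun k : ℕ => (k : ℝ≥0∞))).comp
    (Finset.measurable_sum Finset.univ fun (i : Fin N) _ => h.comp (measurable_pi_apply i))

theorem integral_exp_clusterProcess {G : Measure (S × ℝ)} [IsFiniteMeasure G]
    (hG : ∀ᵐ z ∂G, ∃ m : ℕ, 1 ≤ m ∧ z.2 = (m : ℝ)) {k : ℕ} {B : Fin k → Set S}
    (hB : ∀ i, MeasurableSet (B i)) (t : Fin k → ℝ) :
    ∫ ω, Complex.exp (Complex.I * (∑ l, t l * (clusterProcess ω (B l)).toReal : ℝ))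
        ∂poissonLaw G =
      Complex.exp (∫ z, (Complex.exp (Complex.I *
        (∑ l, (B l).indicator (fun _ => t l) z.1 * z.2 : ℝ)) - 1) ∂G) := by
  classical
  let g : S × ℝ → ℝ := fun z => ∑ l, (B l).indicator (fun _ => t l) z.1 * (⌊z.2⌋₊ : ℝ)
  have hg : Measurable g := Finset.measurable_sum _ fun l _ =>
    ((measurable_const.indicator (hB l)).comp measurable_fst).mul
      ((measurable_from_top (f := fun k : ℕ => (k : ℝ))).comp
        (Nat.measurable_floor.comp measurable_snd))
  have h1 : ∀ ω : Σ N : ℕ, Fin N → S × ℝ,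
      Complex.exp (Complex.I * (∑ l, t l * (clusterProcess ω (B l)).toReal : ℝ)) =
        ∏ i, Complex.exp (Complex.I * g (ω.2 i)) := fun ω => by
    rw [← Complex.exp_sum, ← Finset.mul_sum, ← Complex.ofReal_sum, Finset.sum_comm]
    congr 3
    refine Finset.sum_congr rfl fun l _ => ?_
    rw [clusterProcess_apply ω (hB l), ENNReal.toReal_natCast, Nat.cast_sum, Finset.mul_sum]
    refine Finset.sum_congr rfl fun i _ => ?_
    by_cases hi : (ω.2 i).1 ∈ B l <;> simp [hi]
  simp only [h1]
  rw [integral_prod_poissonLaw G (h := fun z => Complex.exp (Complex.I * g z)) (by fun_prop)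
    fun z => by rw [mul_comm, Complex.norm_exp_ofReal_mul_I]]
  congr 1
  refine integral_congr_ae ?_
  filter_upwards [hG] with z ⟨m, _, hm⟩
  simp only [g, hm, Nat.floor_natCast]

end ClusterProcess

/-! ### Independence on disjoint sets -/

/-- A point lies in at most one of several disjoint sets, so that only one summand is not `0`. -/
theorem apply_sum_indicator {ι S M : Type*} [Fintype ι] [AddCommMonoid M] {B : ι → Set S}
    (hB : Pairwise fun i j => Disjoint (B i) (B j)) {f : ℝ → M} (hf : f 0 = 0) (t : ι → ℝ) (x : S) :
    f (∑ l, (B l).indicator (fun _ => t l) x) = ∑ l, f ((B l).indicator (fun _ => t l) x) := by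
  classical
  by_cases hx : ∃ i, x ∈ B i
  · obtain ⟨i, hi⟩ := hx
    have h : ∀ l, l ≠ i → (B l).indicator (fun _ => t l) x = 0 := fun l hl =>
      Set.indicator_of_notMem (fun hxl => Set.disjoint_left.mp (hB hl) hxl hi) _
    rw [Finset.sum_eq_single i (fun l _ hl => h l hl) (by simp),
      Finset.sum_eq_single i (fun l _ hl => by rw [h l hl, hf]) (by simp)]
  · have h : ∀ l, (B l).indicator (fun _ => t l) x = 0 := fun l =>
      Set.indicator_of_notMem (fun hxl => hx ⟨l, hxl⟩) _
    simp [h, hf]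

theorem apply_sum_indicator_eq_prod {ι S : Type*} [Fintype ι] {B : ι → Set S}
    (hB : Pairwise fun i j => Disjoint (B i) (B j)) {f : ℝ → ℂ} (hf : f 0 = 1) (t : ι → ℝ) (x : S) :
    f (∑ l, (B l).indicator (fun _ => t l) x) = ∏ l, f ((B l).indicator (fun _ => t l) x) :=
  apply_sum_indicator (M := Additive ℂ) hB hf t x

/-- Kac's criterion for finite variables with values in `[0, ∞]`. -/
theorem iIndepFun_of_integral_exp {Ω : Type*} [MeasurableSpace Ω] {P : Measure Ω}
    [IsProbabilityMeasure P] {k : ℕ} {X : Fin k → Ω → ℝ≥0∞} (hX : ∀ l, Measurable (X l))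
    (hfin : ∀ l ω, X l ω < ∞)
    (h : ∀ t : Fin k → ℝ, ∫ ω, Complex.exp (Complex.I * (∑ l, t l * (X l ω).toReal : ℝ)) ∂P =
      ∏ l, charFun (P.map fun ω => (X l ω).toReal) (t l)) : iIndepFun X P := by
  have hY : ∀ l, Measurable fun ω => (X l ω).toReal := fun l => (hX l).ennreal_toReal
  have h1 : iIndepFun (fun l ω => (X l ω).toReal) P := by
    rw [iIndepFun_iff_charFun_pi fun l => (hY l).aemeasurable]
    intro t
    rw [← h t.ofLp, charFun_apply, integral_map (by fun_prop) (by fun_prop)]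
    refine integral_congr_ae (.of_forall fun ω => ?_)
    simp only [PiLp.inner_apply, mul_comm Complex.I]
    simp
  have h2 := h1.comp (fun _ => ENNReal.ofReal) fun _ => ENNReal.measurable_ofReal
  refine h2.congr fun l => .of_forall fun ω => ?_
  exact ENNReal.ofReal_toReal (hfin l ω).ne

section Cluster

variable {S : Type u} [MeasurableSpace S]

theorem integral_exp_indicator_sub_one (G : Measure (S × ℝ)) {A : Set S} (hA : MeasurableSet A)
    (θ : ℝ) :
    ∫ z, (Complex.exp (Complex.I * (A.indicator (fun _ => θ) z.1 * z.2 : ℝ)) - 1) ∂G =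
      ∫ z in A ×ˢ (Set.univ : Set ℝ), (Complex.exp (Complex.I * θ * z.2) - 1) ∂G := by
  rw [← integral_indicator (hA.prod MeasurableSet.univ)]
  refine integral_congr_ae (.of_forall fun z => ?_)
  by_cases hz : z.1 ∈ A
  · have : z ∈ A ×ˢ (Set.univ : Set ℝ) := ⟨hz, Set.mem_univ _⟩
    simp [hz, this, mul_assoc]
  · have : z ∉ A ×ˢ (Set.univ : Set ℝ) := fun h => hz h.1
    simp [hz, this]

theorem measurable_clusterProcess_toReal {A : Set S} (hA : MeasurableSet A) :
    Measurable fun ω : Σ N : ℕ, Fin N → S × ℝ => (clusterProcess ω A).toReal :=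
  ((Measure.measurable_coe hA).comp measurable_clusterProcess).ennreal_toReal

theorem charFun_clusterProcess {G : Measure (S × ℝ)} [IsFiniteMeasure G]
    (hG : ∀ᵐ z ∂G, ∃ m : ℕ, 1 ≤ m ∧ z.2 = (m : ℝ)) {A : Set S} (hA : MeasurableSet A) (θ : ℝ) :
    charFun ((poissonLaw G).map fun ω => (clusterProcess ω A).toReal) θ =
      Complex.exp (∫ z in A ×ˢ (Set.univ : Set ℝ), (Complex.exp (Complex.I * θ * z.2) - 1) ∂G) := by
  have h := integral_exp_clusterProcess hG (B := fun _ : Fin 1 => A) (fun _ => hA) fun _ => θ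
  simp only [Finset.univ_unique, Finset.sum_singleton] at h
  rw [← integral_exp_indicator_sub_one G hA, ← h,
    charFun_map_eq_integral (measurable_clusterProcess_toReal hA).aemeasurable]
  refine integral_congr_ae (.of_forall fun ω => ?_)
  simp [mul_assoc]

theorem isCRM_clusterProcess [MetricSpace S] {G : Measure (S × ℝ)} [IsFiniteMeasure G]
    (hG : ∀ᵐ z ∂G, ∃ m : ℕ, 1 ≤ m ∧ z.2 = (m : ℝ)) :
    IsCRM (poissonLaw G) (clusterProcess : (Σ N : ℕ, Fin N → S × ℝ) → Measure S) where
  measurable := measurable_clusterProcess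
  locallyFinite ω A _ _ := clusterProcess_lt_top ω A
  indep k B hB hd := by
    refine iIndepFun_of_integral_exp
      (fun l => (Measure.measurable_coe (hB l)).comp measurable_clusterProcess)
      (fun l ω => clusterProcess_lt_top ω (B l)) fun t => ?_
    rw [integral_exp_clusterProcess hG hB t]
    simp only [charFun_clusterProcess hG (hB _)]
    rw [← Complex.exp_sum]
    simp only [← integral_exp_indicator_sub_one G (hB _)]
    rw [← integral_finsetSum]
    · congr 1
      refine integral_congr_ae (.of_forall fun z => ?_)
      simp only
      rw [← Finset.sum_mul]
      exact apply_sum_indicator hd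
        (f := fun y : ℝ => Complex.exp (Complex.I * (y * z.2 : ℝ)) - 1) (by simp) t z.1
    · intro l _
      have hm : Measurable fun z : S × ℝ => (B l).indicator (fun _ => t l) z.1 :=
        (measurable_const.indicator (hB l)).comp measurable_fst
      refine Integrable.of_bound (C := 2) (by fun_prop) (.of_forall fun z => ?_)
      have := norm_exp_I_mul_sub_one_le 1 ((B l).indicator (fun _ => t l) z.1 * z.2)
      simpa using this

/-- The value at a point has the characteristic function of `δ₀`. -/
theorem isAtomless_clusterProcess [MetricSpace S] [BorelSpace S] {G : Measure (S × ℝ)}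
    [IsFiniteMeasure G] (hG : ∀ᵐ z ∂G, ∃ m : ℕ, 1 ≤ m ∧ z.2 = (m : ℝ))
    (hd : ∀ x : S, ∀ B : Set ℝ, MeasurableSet B → G ({x} ×ˢ B) = 0) :
    IsAtomless (poissonLaw G) (clusterProcess : (Σ N : ℕ, Fin N → S × ℝ) → Measure S) := by
  intro x
  have hm : MeasurableSet ({x} : Set S) := measurableSet_singleton x
  have hX := measurable_clusterProcess_toReal hm
  have : IsProbabilityMeasure ((poissonLaw G).map fun ω => (clusterProcess ω {x}).toReal) :=
    Measure.isProbabilityMeasure_map hX.aemeasurable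
  have h1 : (poissonLaw G).map (fun ω => (clusterProcess ω {x}).toReal) = Measure.dirac 0 := by
    refine Measure.ext_of_charFun (funext fun θ => ?_)
    rw [charFun_clusterProcess hG hm, setIntegral_measure_zero _ (hd x _ MeasurableSet.univ)]
    simp
  have h2 : ∀ᵐ y ∂(poissonLaw G).map (fun ω => (clusterProcess ω {x}).toReal), y = 0 := by
    rw [h1]
    exact (ae_dirac_iff (measurableSet_singleton (0 : ℝ))).mpr rfl
  filter_upwards [ae_of_ae_map hX.aemeasurable h2] with ω hω
  rcases (ENNReal.toReal_eq_zero_iff _).mp hω with h | h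
  · exact h
  · exact absurd h (clusterProcess_lt_top ω _).ne

end Cluster

/-- Independent fixed atoms preserve complete randomness: each point `s j` lies in at most one of
several disjoint sets, so the joint characteristic function still factors. -/
theorem IsCRM.add_sum_dirac {S : Type u} [MetricSpace S] [MeasurableSpace S] {Ω : Type v}
    [MeasurableSpace Ω] {P : Measure Ω} [IsProbabilityMeasure P] {α : Ω → Measure S}
    (hα : IsCRM P α) (hfin : ∀ ω A, α ω A < ∞) {n : ℕ} (s : Fin n → S) {β : Fin n → Ω → ℝ}
    (hβ : ∀ j, Measurable (β j)) (hβ0 : ∀ j ω, 0 ≤ β j ω) (hi : iIndepFun β P)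
    (hαβ : IndepFun α (fun ω j => β j ω) P) :
    IsCRM P fun ω => α ω + ∑ j, ENNReal.ofReal (β j ω) • Measure.dirac (s j) := by
  classical
  have hlt : ∀ ω A, (α ω + ∑ j, ENNReal.ofReal (β j ω) • Measure.dirac (s j)) A < ∞ :=
    fun ω A => by
      refine (measure_mono (Set.subset_univ A)).trans_lt ?_
      rw [Measure.add_apply, Measure.finsetSum_apply]
      refine ENNReal.add_lt_top.mpr ⟨hfin ω _, ENNReal.sum_lt_top.mpr fun j _ => ?_⟩
      simp
  have hmeas : Measurable fun ω => α ω + ∑ j, ENNReal.ofReal (β j ω) • Measure.dirac (s j) := by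
    refine Measure.measurable_of_measurable_coe _ fun A hA => ?_
    simp only [Measure.add_apply, Measure.finsetSum_apply, Measure.smul_apply, smul_eq_mul]
    exact ((Measure.measurable_coe hA).comp hα.measurable).add
      (Finset.measurable_sum _ fun j _ => (hβ j).ennreal_ofReal.mul_const _)
  refine ⟨⟨hmeas, fun ω A _ _ => hlt ω A⟩, fun k B hB hd => ?_⟩
  have hXm : ∀ l, Measurable fun ω => (α ω (B l)).toReal := fun l =>
    hα.toIsRandomMeasure.measurable_toReal (hB l)
  have hXi : iIndepFun (fun l ω => (α ω (B l)).toReal) P :=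
    (hα.indep k B hB hd).comp (fun _ => ENNReal.toReal) fun _ => ENNReal.measurable_toReal
  refine iIndepFun_of_integral_exp (fun l => (Measure.measurable_coe (hB l)).comp hmeas)
    (fun l ω => hlt ω (B l)) fun t => ?_
  simp only [toReal_add_sum_dirac_apply (hB _) (hfin _ _) (fun j => hβ0 j _)]
  have h1 : ∀ ω, ∑ l, t l * ((α ω (B l)).toReal + ∑ j, (if s j ∈ B l then 1 else 0) * β j ω) =
      ∑ l, t l * (α ω (B l)).toReal +
        ∑ j, (∑ l, (B l).indicator (fun _ => t l) (s j)) * β j ω := fun ω => by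
    simp only [mul_add, Finset.sum_add_distrib, Finset.mul_sum, Finset.sum_mul]
    rw [Finset.sum_comm (s := Finset.univ (α := Fin n))]
    congr 1
    refine Finset.sum_congr rfl fun l _ => Finset.sum_congr rfl fun j _ => ?_
    by_cases hj : s j ∈ B l <;> simp [hj]
  have hφ : Measurable fun μ : Measure S => ∑ l, t l * (μ (B l)).toReal :=
    Finset.measurable_sum _ fun l _ => (Measure.measurable_coe (hB l)).ennreal_toReal.const_mul _
  have h2 := charFun_add_sum_mul hα.measurable hφ hβ hi hαβ
    (fun j => ∑ l, (B l).indicator (fun _ => t l) (s j)) 1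
  rw [charFun_map_eq_integral (by
    exact ((hφ.comp hα.measurable).add (by fun_prop)).aemeasurable)] at h2
  simp only [Complex.ofReal_one, mul_one] at h2
  simp only [h1]
  rw [h2, charFun_sum_mul hXm hXi]
  have h3 : ∀ l, charFun (P.map fun ω => (α ω (B l)).toReal +
      ∑ j, (if s j ∈ B l then 1 else 0) * β j ω) (t l) =
      charFun (P.map fun ω => (α ω (B l)).toReal) (t l) *
        ∏ j, charFun (P.map (β j)) ((B l).indicator (fun _ => t l) (s j)) := fun l => by
    rw [charFun_add_sum_mul hα.measurable (φ := fun μ : Measure S => (μ (B l)).toReal)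
      (Measure.measurable_coe (hB l)).ennreal_toReal hβ hi hαβ]
    congr 1
    refine Finset.prod_congr rfl fun j _ => ?_
    by_cases hj : s j ∈ B l <;> simp [hj]
  simp only [h3]
  rw [Finset.prod_mul_distrib, Finset.prod_comm (s := Finset.univ (α := Fin k))]
  simp only [mul_one]
  congr 1
  refine Finset.prod_congr rfl fun j _ => ?_
  have : IsProbabilityMeasure (P.map (β j)) := Measure.isProbabilityMeasure_map (hβ j).aemeasurable
  exact apply_sum_indicator_eq_prod hd (by simp) t (s j)

/-! ### Uniqueness in law -/

section Uniqueness

variable {S : Type u} [MeasurableSpace S]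

/-- The σ-algebra on measures is generated by the map to the product indexed by measurable sets. -/
theorem instMeasurableSpace_le_comap_eval :
    (Measure.instMeasurableSpace : MeasurableSpace (Measure S)) ≤
      MeasurableSpace.comap (fun (μ : Measure S) (A : {A : Set S // MeasurableSet A}) => μ A.1)
        MeasurableSpace.pi := by
  refine iSup₂_le fun A hA => ?_
  rintro _ ⟨s, hs, rfl⟩
  exact ⟨_, measurable_pi_apply (⟨A, hA⟩ : {A : Set S // MeasurableSet A}) hs, rfl⟩

/-- The law of a random measure is determined by the joint laws of its values. -/
theorem map_measure_eq_of_finite_dimensional {Ω : Type*} [MeasurableSpace Ω] {P : Measure Ω}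
    [IsFiniteMeasure P] {Ω' : Type*} [MeasurableSpace Ω'] {P' : Measure Ω'}
    {ξ : Ω → Measure S} {ξ' : Ω' → Measure S} (hξ : Measurable ξ) (hξ' : Measurable ξ')
    (h : ∀ J : Finset {A : Set S // MeasurableSet A},
      P'.map (fun ω (A : J) => ξ' ω A.1.1) = P.map fun ω (A : J) => ξ ω A.1.1) :
    P'.map ξ' = P.map ξ := by
  let Φ : Measure S → {A : Set S // MeasurableSet A} → ℝ≥0∞ := fun μ A => μ A.1
  have hΦ : Measurable Φ := measurable_pi_lambda _ fun A => Measure.measurable_coe A.2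
  have hlim : (P'.map ξ').map Φ = (P.map ξ).map Φ := by
    rw [Measure.map_map hΦ hξ', Measure.map_map hΦ hξ]
    have hfin : ∀ J : Finset {A : Set S // MeasurableSet A},
        IsFiniteMeasure (P.map fun ω (A : J) => ξ ω A.1.1) := fun J => inferInstance
    refine IsProjectiveLimit.unique (P := fun J => P.map fun ω (A : J) => ξ ω A.1.1)
      (fun J => ?_) fun J => ?_
    · rw [Measure.map_map (Finset.measurable_restrict J) (hΦ.comp hξ')]
      exact h J
    · rw [Measure.map_map (Finset.measurable_restrict J) (hΦ.comp hξ)]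
      rfl
  ext E hE
  obtain ⟨D, hD, rfl⟩ := instMeasurableSpace_le_comap_eval E hE
  have := congrArg (fun ρ => ρ D) hlim
  simp only [Measure.map_apply hΦ hD] at this
  exact this

theorem map_eq_map_ofReal_toReal {Ω : Type*} [MeasurableSpace Ω] {P : Measure Ω} {X : Ω → ℝ≥0∞}
    (hX : Measurable X) (hf : ∀ᵐ ω ∂P, X ω < ∞) :
    P.map X = (P.map fun ω => (X ω).toReal).map ENNReal.ofReal := by
  rw [Measure.map_map ENNReal.measurable_ofReal hX.ennreal_toReal]
  refine Measure.map_congr ?_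
  filter_upwards [hf] with ω hω using (ENNReal.ofReal_toReal hω.ne).symm

theorem map_eq_of_charFun_toReal_eq {Ω : Type*} [MeasurableSpace Ω] {P : Measure Ω}
    [IsFiniteMeasure P] {Ω' : Type*} [MeasurableSpace Ω'] {P' : Measure Ω'} [IsFiniteMeasure P']
    {X : Ω → ℝ≥0∞} {X' : Ω' → ℝ≥0∞} (hX : Measurable X) (hX' : Measurable X')
    (hf : ∀ᵐ ω ∂P, X ω < ∞) (hf' : ∀ᵐ ω ∂P', X' ω < ∞)
    (h : ∀ θ, charFun (P'.map fun ω => (X' ω).toReal) θ = charFun (P.map fun ω => (X ω).toReal) θ) :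
    P'.map X' = P.map X := by
  have h1 : P'.map (fun ω => (X' ω).toReal) = P.map fun ω => (X ω).toReal :=
    Measure.ext_of_charFun (funext h)
  rw [map_eq_map_ofReal_toReal hX' hf', map_eq_map_ofReal_toReal hX hf, h1]

/-- The law of a completely random measure is determined by its one-dimensional laws: the values
on arbitrary sets are sums of the values on the atoms of the generated finite partition, and the
latter are independent. -/
theorem IsCRM.map_eq [MetricSpace S] {Ω : Type*} [MeasurableSpace Ω] {P : Measure Ω}
    [IsProbabilityMeasure P] {Ω' : Type*} [MeasurableSpace Ω'] {P' : Measure Ω'}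
    [IsProbabilityMeasure P'] {ξ : Ω → Measure S} {ξ' : Ω' → Measure S} (hξ : IsCRM P ξ)
    (hξ' : IsCRM P' ξ')
    (h : ∀ A, MeasurableSet A → P'.map (fun ω => ξ' ω A) = P.map fun ω => ξ ω A) :
    P'.map ξ' = P.map ξ := by
  classical
  refine map_measure_eq_of_finite_dimensional hξ.measurable hξ'.measurable fun J => ?_
  -- `code x` records which members of `J` contain `x`; its fibres are the atoms of the partition
  let e := Fintype.equivFin (J → Bool)
  let code : S → J → Bool := fun x A => decide (x ∈ A.1.1)
  have hcode : Measurable code := by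
    refine measurable_pi_lambda _ fun A => measurable_to_bool ?_
    have : (fun x => code x A) ⁻¹' {true} = A.1.1 := by
      ext x
      simp [code]
    rw [this]
    exact A.1.2
  let D : Fin (Fintype.card (J → Bool)) → Set S := fun i => code ⁻¹' {e.symm i}
  have hD : ∀ i, MeasurableSet (D i) := fun i => hcode (measurableSet_singleton _)
  have hdisj : Pairwise fun i j => Disjoint (D i) (D j) := fun i j hij =>
    Disjoint.preimage _ (by simpa using hij)
  have hunion : ∀ A : J, A.1.1 = ⋃ i ∈ Finset.univ.filter (fun i => e.symm i A = true), D i :=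
    fun A => by
      ext x
      simp only [D, Finset.mem_filter, Finset.mem_univ, true_and, Set.mem_iUnion, Set.mem_preimage,
        Set.mem_singleton_iff, exists_prop]
      constructor
      · intro hx
        exact ⟨e (code x), by simpa [code] using hx, by simp⟩
      · rintro ⟨i, hi, hxi⟩
        rw [← hxi] at hi
        simpa [code] using hi
  let Ψ : (Fin (Fintype.card (J → Bool)) → ℝ≥0∞) → J → ℝ≥0∞ := fun y A =>
    ∑ i ∈ Finset.univ.filter (fun i => e.symm i A = true), y i
  have hΨ : Measurable Ψ := measurable_pi_lambda _ fun A =>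
    Finset.measurable_sum _ fun i _ => measurable_pi_apply i
  have hval : ∀ (μ : Measure S), (fun A : J => μ A.1.1) = Ψ fun i => μ (D i) := fun μ => by
    funext A
    conv_lhs => rw [hunion A]
    exact measure_biUnion_finset (fun i _ j _ hij => hdisj hij) fun i _ => hD i
  have hm : Measurable fun ω i => ξ ω (D i) :=
    measurable_pi_lambda _ fun i => (Measure.measurable_coe (hD i)).comp hξ.measurable
  have hm' : Measurable fun ω i => ξ' ω (D i) :=
    measurable_pi_lambda _ fun i => (Measure.measurable_coe (hD i)).comp hξ'.measurable
  have g1 : (fun ω (A : J) => ξ ω A.1.1) = fun ω => Ψ fun i => ξ ω (D i) :=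
    funext fun ω => hval (ξ ω)
  have g2 : (fun ω (A : J) => ξ' ω A.1.1) = fun ω => Ψ fun i => ξ' ω (D i) :=
    funext fun ω => hval (ξ' ω)
  rw [g1, g2]
  have e1 := Measure.map_map (μ := P) hΨ hm
  have e2 := Measure.map_map (μ := P') hΨ hm'
  simp only [Function.comp_def] at e1 e2
  rw [← e1, ← e2,
    (hξ.indep _ D hD hdisj).map_fun_eq_pi_map fun i => (hm.eval (a := i)).aemeasurable,
    (hξ'.indep _ D hD hdisj).map_fun_eq_pi_map fun i => (hm'.eval (a := i)).aemeasurable]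
  exact congrArg (fun m => (Measure.pi m).map Ψ) (funext fun i => h _ (hD i))

end Uniqueness

/-! ### Construction from an explicit pair -/

/-- The probability distribution on `ℕ` with generating polynomial `p`. -/
noncomputable def weightLaw (p : ℝ[X]) : Measure ℕ :=
  ∑ l ∈ p.support, ENNReal.ofReal (p.coeff l) • Measure.dirac l

theorem weightLaw_singleton (p : ℝ[X]) (l : ℕ) : weightLaw p {l} = ENNReal.ofReal (p.coeff l) := by
  rw [weightLaw, Measure.finsetSum_apply]
  simp only [Measure.smul_apply, Measure.dirac_apply, smul_eq_mul, Set.indicator_apply,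
    Set.mem_singleton_iff, Pi.one_apply, mul_ite, mul_one, mul_zero, Finset.sum_ite_eq',
    mem_support_iff]
  split_ifs with h
  · rfl
  · rw [not_not.mp h, ENNReal.ofReal_zero]

theorem ae_mem_support_weightLaw (p : ℝ[X]) : ∀ᵐ l ∂weightLaw p, l ∈ p.support := by
  rw [ae_iff_of_countable]
  intro l hl
  rw [weightLaw_singleton] at hl
  rw [mem_support_iff]
  rintro h
  rw [h, ENNReal.ofReal_zero] at hl
  exact hl rfl

theorem IsWeightPolynomial.isProbabilityMeasure_weightLaw {p : ℝ[X]} (hp : IsWeightPolynomial p) :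
    IsProbabilityMeasure (weightLaw p) := by
  refine ⟨?_⟩
  rw [weightLaw, Measure.finsetSum_apply]
  simp only [Measure.smul_apply, measure_univ, smul_eq_mul, mul_one]
  rw [← ENNReal.ofReal_sum_of_nonneg fun l _ => hp.coeff_nonneg l]
  have h := hp.eval_one
  rw [eval_eq_sum, Polynomial.sum] at h
  simp only [one_pow, mul_one] at h
  rw [h, ENNReal.ofReal_one]

theorem IsWeightPolynomial.charFun_weightLaw {p : ℝ[X]} (hp : IsWeightPolynomial p) (θ : ℝ) :
    charFun ((weightLaw p).map fun l : ℕ => (l : ℝ)) θ = aeval (Complex.exp (Complex.I * θ)) p := by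
  have h : aeval (Complex.exp (Complex.I * θ)) p =
      ∑ l ∈ p.support, p.coeff l • Complex.exp (Complex.I * θ) ^ l := by
    rw [aeval_eq_sum_range]
    refine (Finset.sum_subset supp_subset_range_natDegree_succ fun l _ hl => ?_).symm
    rw [notMem_support_iff.mp hl, zero_smul]
  rw [charFun_map_eq_integral (by fun_prop), weightLaw, integral_finsetSum_measure, h]
  · refine Finset.sum_congr rfl fun l _ => ?_
    rw [integral_smul_measure, integral_dirac, ENNReal.toReal_ofReal (hp.coeff_nonneg l),
      ← Complex.exp_nat_mul, Complex.ofReal_natCast, mul_comm (l : ℂ)]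
  · intro l _
    exact (integrable_dirac (by simp)).smul_measure ENNReal.ofReal_ne_top

theorem measurable_centering : Measurable centering :=
  measurable_id.indicator measurableSet_Icc

theorem norm_centering_le (x : ℝ) : ‖((centering x : ℝ) : ℂ)‖ ≤ 1 := by
  rw [Complex.norm_real, centering, Real.norm_eq_abs]
  by_cases hx : x ∈ Set.Icc (-1 : ℝ) 1
  · rw [Set.indicator_of_mem hx]
    exact abs_le.mpr hx
  · rw [Set.indicator_of_notMem hx, abs_zero]
    exact zero_le_one

theorem IsRootMeasure.singleton_zero {p : ℝ[X]} {b : SignedMeasure ℝ} (hb : IsRootMeasure p b) :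
    b {0} = 0 := by
  have h := hb {0} (measurableSet_singleton 0)
  have h1 : ∀ i : ℕ, diracValue (-((i + 1 : ℕ) : ℝ)) {0} = 0 := fun i =>
    Set.indicator_of_notMem (by
      rw [Set.mem_singleton_iff, neg_eq_zero]; exact_mod_cast Nat.succ_ne_zero i) _
  have h2 : ∀ i : ℕ, diracValue ((i + 1 : ℕ) : ℝ) {0} = 0 := fun i =>
    Set.indicator_of_notMem (by
      rw [Set.mem_singleton_iff]; exact_mod_cast Nat.succ_ne_zero i) _
  simp only [h1, h2, Complex.ofReal_zero, mul_zero, neg_zero, sub_zero] at h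
  exact_mod_cast (hasSum_zero.unique h).symm

/-- The Jordan parts of a finite signed measure on `ℝ` without an atom at `0`, as a quasi-Lévy type
measure. -/
noncomputable def jordanQuasiLevy (b : SignedMeasure ℝ) (h0 : b {0} = 0) :
    QuasiLevyTypeMeasure where
  pos := b.toJordanDecomposition.posPart
  neg := b.toJordanDecomposition.negPart
  mutuallySingular := b.toJordanDecomposition.mutuallySingular
  pos_zero := by
    have h1 := b.apply_eq_posPart_real_sub_negPart_real (measurableSet_singleton 0)
    obtain ⟨U, hU, hU1, hU2⟩ := b.toJordanDecomposition.mutuallySingular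
    by_cases h : (0 : ℝ) ∈ U
    · exact measure_mono_null (Set.singleton_subset_iff.mpr h) hU1
    · have h2 : b.toJordanDecomposition.negPart {0} = 0 :=
        measure_mono_null (Set.singleton_subset_iff.mpr h) hU2
      rw [h0, measureReal_def, measureReal_def, h2, ENNReal.toReal_zero, sub_zero] at h1
      exact ((ENNReal.toReal_eq_zero_iff _).mp h1.symm).resolve_right (measure_ne_top _ _)
  neg_zero := by
    have h1 := b.apply_eq_posPart_real_sub_negPart_real (measurableSet_singleton 0)
    obtain ⟨U, hU, hU1, hU2⟩ := b.toJordanDecomposition.mutuallySingular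
    by_cases h : (0 : ℝ) ∈ U
    · have h2 : b.toJordanDecomposition.posPart {0} = 0 :=
        measure_mono_null (Set.singleton_subset_iff.mpr h) hU1
      rw [h0, measureReal_def, measureReal_def, h2, ENNReal.toReal_zero, zero_sub, eq_comm,
        neg_eq_zero] at h1
      exact ((ENNReal.toReal_eq_zero_iff _).mp h1).resolve_right (measure_ne_top _ _)
    · exact measure_mono_null (Set.singleton_subset_iff.mpr h) hU2
  lintegral_lt_top := by
    refine lt_of_le_of_lt
      (lintegral_mono fun x => ENNReal.ofReal_le_ofReal (min_le_left 1 (x ^ 2))) ?_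
    rw [lintegral_const, ENNReal.ofReal_one, one_mul]
    exact measure_lt_top _ _

/-- A law whose characteristic function is the exponential of a drift and a finite signed measure
without an atom at `0` is quasi-infinitely divisible. Centering changes the drift only. -/
theorem isQID_of_charFun_eq {μ : Measure ℝ} {b : SignedMeasure ℝ} (h0 : b {0} = 0) {c : ℝ}
    (h : ∀ θ : ℝ, charFun μ θ = Complex.exp (Complex.I * θ * c +
      signedIntegral b fun x => Complex.exp (Complex.I * θ * x) - 1)) : IsQID μ := by
  set J := b.toJordanDecomposition with hJ
  refine ⟨c + (∫ x, centering x ∂J.posPart - ∫ x, centering x ∂J.negPart), 0,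
    jordanQuasiLevy b h0, fun θ => ?_⟩
  have hcint : ∀ (ρ : Measure ℝ) [IsFiniteMeasure ρ],
      Integrable (fun x => Complex.I * θ * ((centering x : ℝ) : ℂ)) ρ := fun ρ _ =>
    (Integrable.of_bound (by have := measurable_centering; fun_prop) 1
      (.of_forall norm_centering_le)).const_mul _
  have heint : ∀ (ρ : Measure ℝ) [IsFiniteMeasure ρ],
      Integrable (fun x : ℝ => Complex.exp (Complex.I * θ * x) - 1) ρ := fun ρ _ =>
    Integrable.of_bound (stronglyMeasurable_exp_I_mul_sub_one θ).aestronglyMeasurable 2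
      (.of_forall (norm_exp_I_mul_sub_one_le θ))
  have hQ : (jordanQuasiLevy b h0).integral
      (fun x => Complex.exp (Complex.I * θ * x) - 1 - Complex.I * θ * (centering x : ℝ)) =
      signedIntegral b (fun x => Complex.exp (Complex.I * θ * x) - 1) -
        Complex.I * θ * ((∫ x, centering x ∂J.posPart - ∫ x, centering x ∂J.negPart : ℝ) : ℂ) := by
    have hcong : ∀ ρ : Measure ℝ,
        ∫ x, ((centering x : ℝ) : ℂ) ∂ρ = ((∫ x, centering x ∂ρ : ℝ) : ℂ) :=
      fun ρ => integral_ofReal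
    change ∫ x, _ ∂J.posPart - ∫ x, _ ∂J.negPart =
      (∫ x, _ ∂J.posPart - ∫ x, _ ∂J.negPart) - _
    rw [integral_sub (heint _) (hcint _), integral_sub (heint _) (hcint _), integral_const_mul,
      integral_const_mul, hcong, hcong]
    push_cast
    ring
  rw [h, hQ]
  congr 1
  push_cast
  ring

theorem iIndepFun_comp_measurePreserving {Ω Ω' E : Type*} [MeasurableSpace Ω] [MeasurableSpace Ω']
    [MeasurableSpace E] {P : Measure Ω} [IsProbabilityMeasure P] {Q : Measure Ω'}
    [IsProbabilityMeasure Q] {f : Ω → Ω'} (hf : MeasurePreserving f P Q) {ι : Type*} [Fintype ι]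
    {Y : ι → Ω' → E} (hY : ∀ i, Measurable (Y i)) (h : iIndepFun Y Q) :
    iIndepFun (fun i ω => Y i (f ω)) P := by
  rw [iIndepFun_iff_map_fun_eq_pi_map fun i => (hY i).aemeasurable, ← hf.map_eq,
    Measure.map_map (measurable_pi_lambda _ hY) hf.measurable] at h
  have hm : ∀ i, Measurable fun ω => Y i (f ω) := fun i => (hY i).comp hf.measurable
  rw [iIndepFun_iff_map_fun_eq_pi_map fun i => (hm i).aemeasurable]
  refine h.trans (congrArg Measure.pi (funext fun i => ?_))
  rw [Measure.map_map (hY i) hf.measurable]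
  rfl

section Construction

variable {S : Type u} [MetricSpace S] [MeasurableSpace S] [BorelSpace S]

/-- The random measure attached to the data of an explicit pair: a Poisson cluster process with
intensity `G` and, independently, fixed atoms at the points `s j` with generating polynomials
`p j`. -/
theorem exists_isDecomposition {n : ℕ} {s : Fin n → S} (hs : Function.Injective s)
    {p : Fin n → ℝ[X]} (hp : ∀ j, IsWeightPolynomial (p j)) {ν₀ : SignedMeasure S}
    {F : SignedMeasure (S × ℝ)} {G : Measure (S × ℝ)} {b : Fin n → SignedMeasure ℝ}
    (hGfin : IsFiniteMeasure G) (hG : ∀ᵐ z ∂G, ∃ m : ℕ, 1 ≤ m ∧ z.2 = (m : ℝ))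
    (hGd : ∀ x : S, ∀ B : Set ℝ, MeasurableSet B → G ({x} ×ˢ B) = 0)
    (hb : ∀ j, IsRootMeasure (p j) (b j))
    (hν : ∀ A : Set S, MeasurableSet A →
      ν₀ A = ∑ j, diracValue (s j) A * ((innerRoots (p j)).card : ℝ))
    (hF : ∀ (A : Set S) (B : Set ℝ), MeasurableSet A → MeasurableSet B →
      F (A ×ˢ B) = (G (A ×ˢ B)).toReal + ∑ j, diracValue (s j) A * b j B) :
    ∃ (Ω : Type u) (_ : MeasurableSpace Ω) (P : Measure Ω) (ξ : Ω → Measure S),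
      IsProbabilityMeasure P ∧ MemClass P ξ ∧ HasLevyKhintchine P ξ ν₀ F := by
  have hprob : ∀ j, IsProbabilityMeasure (weightLaw (p j)) := fun j =>
    (hp j).isProbabilityMeasure_weightLaw
  let Ω := (Σ N : ℕ, Fin N → S × ℝ) × (Fin n → ℕ)
  let Q : Measure (Fin n → ℕ) := Measure.pi fun j => weightLaw (p j)
  let P : Measure Ω := (poissonLaw G).prod Q
  let α : Ω → Measure S := fun ω => clusterProcess ω.1
  let β : Fin n → Ω → ℝ := fun j ω => (ω.2 j : ℝ)
  have hfst : MeasurePreserving Prod.fst P (poissonLaw G) := measurePreserving_fst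
  have hsnd : ∀ j, MeasurePreserving (fun ω : Ω => ω.2 j) P (weightLaw (p j)) := fun j =>
    (measurePreserving_eval (fun j => weightLaw (p j)) j).comp measurePreserving_snd
  have hcast : Measurable fun l : ℕ => (l : ℝ) := measurable_from_top
  have hβ : ∀ j, Measurable (β j) := fun j => hcast.comp (hsnd j).measurable
  have hβlaw : ∀ j, P.map (β j) = (weightLaw (p j)).map fun l : ℕ => (l : ℝ) := fun j => by
    rw [← (hsnd j).map_eq, Measure.map_map hcast (hsnd j).measurable]
    rfl
  have hβc : ∀ j, ∀ θ : ℝ, charFun (P.map (β j)) θ = aeval (Complex.exp (Complex.I * θ)) (p j) :=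
    fun j θ => by rw [hβlaw, (hp j).charFun_weightLaw]
  have hβi : iIndepFun β P := by
    have h1 : iIndepFun (fun (j : Fin n) (y : Fin n → ℕ) => (y j : ℝ)) Q :=
      iIndepFun_pi (X := fun _ (l : ℕ) => (l : ℝ)) fun _ => hcast.aemeasurable
    exact iIndepFun_comp_measurePreserving (f := Prod.snd) measurePreserving_snd
      (fun j => hcast.comp (measurable_pi_apply j)) h1
  have hαβ : IndepFun α (fun ω j => β j ω) P :=
    indepFun_prod measurable_clusterProcess
      (measurable_pi_lambda _ fun j => hcast.comp (measurable_pi_apply j))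
  have hαm : Measurable α := measurable_clusterProcess.comp measurable_fst
  have hαfin : ∀ ω A, α ω A < ∞ := fun ω A => clusterProcess_lt_top ω.1 A
  have hαr : IsRandomMeasure α := ⟨hαm, fun ω A _ _ => hαfin ω A⟩
  have hαc : ∀ A : Set S, MeasurableSet A → ∀ θ : ℝ,
      charFun (P.map fun ω => (α ω A).toReal) θ =
        Complex.exp (∫ z in A ×ˢ (Set.univ : Set ℝ), (Complex.exp (Complex.I * θ * z.2) - 1) ∂G) :=
    fun A hA θ => by
      rw [← charFun_clusterProcess hG hA, ← hfst.map_eq,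
        Measure.map_map (measurable_clusterProcess_toReal hA) measurable_fst]
      rfl
  have hαcrm : IsCRM P α := by
    refine ⟨hαr, fun k B hB hd => ?_⟩
    have h1 := (isCRM_clusterProcess hG).indep k B hB hd
    exact iIndepFun_comp_measurePreserving hfst
      (fun i => (Measure.measurable_coe (hB i)).comp measurable_clusterProcess) h1
  have hαa : IsAtomless P α := fun x =>
    hfst.quasiMeasurePreserving.ae (isAtomless_clusterProcess hG hGd x)
  have hβ0 : ∀ j ω, 0 ≤ β j ω := fun j ω => Nat.cast_nonneg _
  let ξ : Ω → Measure S := fun ω => α ω + ∑ j, ENNReal.ofReal (β j ω) • Measure.dirac (s j)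
  have hdec : IsDecomposition P ξ α s β := by
    refine ⟨hαcrm, ⟨hαr, fun ω A hA _ => ⟨_, clusterProcess_apply ω.1 hA⟩⟩, hαa,
      ⟨0, G, ⟨fun A _ _ => by simp, ?_, fun A _ _ => ?_, fun A hA _ θ => ?_⟩, hGfin⟩, hs,
      fun j => ?_, hβ, fun j => ?_, fun j => ⟨(p j).support, ?_⟩, hβi, hαβ, .of_forall fun ω => rfl⟩
    · filter_upwards [hG] with z ⟨m, hm1, hm2⟩
      rw [hm2]
      exact_mod_cast hm1
    · refine lt_of_le_of_lt
        (lintegral_mono fun z => ENNReal.ofReal_le_ofReal (min_le_left 1 z.2)) ?_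
      rw [lintegral_const, ENNReal.ofReal_one, one_mul]
      exact measure_lt_top _ _
    · rw [hαc A hA]
      simp
    -- the value `natDegree (p j) ≥ 1` is taken with positive probability
    · have h1 : P {ω | ω.2 j = (p j).natDegree} =
          ENNReal.ofReal ((p j).coeff (p j).natDegree) := by
        rw [← weightLaw_singleton, ← (hsnd j).measure_preimage
          (measurableSet_singleton _).nullMeasurableSet]
        rfl
      have h2 : 0 < (p j).coeff (p j).natDegree :=
        lt_of_le_of_ne ((hp j).coeff_nonneg _)
          (leadingCoeff_ne_zero.mpr (hp j).ne_zero).symm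
      refine lt_of_lt_of_le (ENNReal.ofReal_pos.mpr h2) (h1.symm.le.trans (measure_mono ?_))
      intro ω hω
      have hω' : ω.2 j = (p j).natDegree := hω
      have h3 : 0 < β j ω := by
        have := (hp j).natDegree_pos
        simp only [β, hω']
        exact_mod_cast this
      have h4 : ENNReal.ofReal (β j ω) ≤ ξ ω {s j} := by
        simp only [ξ, Measure.add_apply, Measure.finsetSum_apply]
        refine le_trans ?_ le_add_self
        refine le_trans ?_ (Finset.single_le_sum
          (f := fun i => (ENNReal.ofReal (β i ω) • Measure.dirac (s i)) {s j})
          (fun i _ => zero_le) (Finset.mem_univ j))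
        simp
      exact lt_of_lt_of_le (ENNReal.ofReal_pos.mpr h3) h4
    · exact isQID_of_charFun_eq (hb j).singleton_zero fun θ => by
        rw [hβc, (hb j).aeval_exp_eq (hp j)]
    · filter_upwards [(hsnd j).quasiMeasurePreserving.ae (ae_mem_support_weightLaw (p j))] with ω hω
      exact ⟨ω.2 j, hω, rfl⟩
  refine ⟨Ω, inferInstance, P, ξ, inferInstance,
    ⟨hαcrm.add_sum_dirac hαfin s hβ hβ0 hβi hαβ, n, α, s, β, hdec⟩, ?_⟩
  exact hasLevyKhintchine_of_eq_ae hαr (.of_forall fun ω => hαfin ω _) hαc hβ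
    (fun j => .of_forall (hβ0 j)) hβi hαβ (.of_forall fun ω => rfl) hβc hp hb hν hF

end Construction

theorem HasLevyKhintchine.map_eq {S : Type u} [MetricSpace S] [MeasurableSpace S] {Ω : Type*}
    [MeasurableSpace Ω] {P : Measure Ω} [IsProbabilityMeasure P] {Ω' : Type*} [MeasurableSpace Ω']
    {P' : Measure Ω'} [IsProbabilityMeasure P'] {ξ : Ω → Measure S} {ξ' : Ω' → Measure S}
    {ν₀ : SignedMeasure S} {F : SignedMeasure (S × ℝ)} (hξ : IsCRM P ξ) (hξ' : IsCRM P' ξ')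
    (h : HasLevyKhintchine P ξ ν₀ F) (h' : HasLevyKhintchine P' ξ' ν₀ F) :
    P'.map ξ' = P.map ξ :=
  hξ.map_eq hξ' fun A hA => map_eq_of_charFun_toReal_eq
    ((Measure.measurable_coe hA).comp hξ.measurable)
    ((Measure.measurable_coe hA).comp hξ'.measurable) (h A hA).1 (h' A hA).1
    fun θ => ((h' A hA).2 θ).trans ((h A hA).2 θ).symm

end QIDRM

theorem mainTheorem7 {S : Type u} [MetricSpace S] [CompleteSpace S]
    [TopologicalSpace.SeparableSpace S] [MeasurableSpace S] [BorelSpace S] :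
    -- the pair of an element of the class, for any decomposition of it
    (∀ (Ω : Type v) [MeasurableSpace Ω] (P : Measure Ω) [IsProbabilityMeasure P]
      (ξ : Ω → Measure S), IsCRM P ξ →
      ∀ (n : ℕ) (α : Ω → Measure S) (s : Fin n → S) (β : Fin n → Ω → ℝ),
        IsDecomposition P ξ α s β →
        ∃ p : Fin n → ℝ[X], (∀ j l, (p j).coeff l = P.real {ω | β j ω = (l : ℝ)}) ∧
          ∃ (ν₀ : SignedMeasure S) (F : SignedMeasure (S × ℝ)),
            IsExplicitPair ν₀ F s p ∧ HasLevyKhintchine P ξ ν₀ F) ∧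
    -- every explicit pair comes from an element of the class, unique in law
    (∀ (n : ℕ) (s : Fin n → S) (p : Fin n → ℝ[X])
      (ν₀ : SignedMeasure S) (F : SignedMeasure (S × ℝ)), IsExplicitPair ν₀ F s p →
      ∃ (Ω : Type u) (_ : MeasurableSpace Ω) (P : Measure Ω) (ξ : Ω → Measure S),
        IsProbabilityMeasure P ∧ MemClass P ξ ∧ HasLevyKhintchine P ξ ν₀ F ∧
        ∀ (Ω' : Type v) [MeasurableSpace Ω'] (P' : Measure Ω') [IsProbabilityMeasure P']
          (ξ' : Ω' → Measure S), IsCRM P' ξ' → HasLevyKhintchine P' ξ' ν₀ F →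
          P'.map ξ' = P.map ξ) := by
  have : SecondCountableTopology S := UniformSpace.secondCountable_of_separable S
  refine ⟨fun Ω _ P _ ξ _ n α s β h => h.exists_explicitPair, ?_⟩
  intro n s p ν₀ F ⟨hs, hp, hν, G, b, hGfin, hG, hGd, hb, hF⟩
  obtain ⟨Ω, mΩ, P, ξ, hP, hmem, hLK⟩ :=
    exists_isDecomposition hs hp hGfin hG hGd hb hν hF
  exact ⟨Ω, mΩ, P, ξ, hP, hmem, hLK, fun Ω' _ P' _ ξ' hξ' hLK' => hLK.map_eq hmem.1 hξ' hLK'⟩
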